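/- Let $\Gamma=(G,\sigma)$ be a signed graph: $G=(V,E)$ is a finite simple graph with $n=|V|\ge 1$ vertices and $\sigma:E\to\{+1,-1\}$. Let $\mu:V\to(0,\infty)$, $w:E\to(0,\infty)$ and $\kappa:V\to\mathbb R$ be a vertex measure, an edge weight and a potential; subgraphs of $\Gamma$ have at least one vertex and carry the restricted data. For $p>1$ let $\Psi_p(t)=|t|^{p-2}t$ for $t\neq0$, $\Psi_p(0)=0$, and $$\Delta_p^\sigma f(i)=\sum_{j\sim i}w_{ij}\Psi_p\big(f(i)-\sigma_{ij}f(j)\big)+\kappa_i\Psi_p(f(i)).$$ An eigenpair $(\lambda,f)$ of $\Delta_p^\sigma$ consists of $\lambda\in\mathbb R$ and $f\ne0$ with $\Delta_p^\sigma f(i)=\lambda\mu_i\Psi_p(f(i))$ for all $i$. For a $p$-th order tensor $\mathcal T=(\mathcal T_{i_1,\dots,i_p})$ with indices in $V$ let $(\mathcal Tx^{p-1})_i=\sum_{i_2,\dots,i_p}\mathcal T_{i,i_2,\dots,i_p}x_{i_2}\cdots x_{i_p}$; $(\lambda,x)$ with $\lambda\in\mathbb R$, $0\ne x\in\mathbb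 R^V$ is an eigenpair of $\mathcal T$ if $(\mathcal Tx^{p-1})_i=\lambda x_i^{p-1}$ for all $i$. For an even integer $p\ge2$ let $\mathcal A^{(p)}$ be the tensor with entries $$\mathcal A^{(p)}_{i,i_2,\dots,i_p}=\begin{cases}\kappa_i+\sum_{j\sim i}w_{ij}&\text{if all indices equal } i,\\(-\sigma_{ij})^l\,w_{ij}&\text{if the indices are } l \text{ copies of } i \text{ and } p-l\ge1 \text{ copies of some } j\sim i,\\0&\text{otherwise,}\end{cases}$$ and let $\mathcal A$ be the $\mu$-normalized tensor $\mathcal A_{i_1,\dots,i_p}=\frac1{\mu_{i_1}}\mathcal A^{(p)}_{i_1,\dots,i_p}$. For a subgraph $\Gamma_0$ of $\Gamma$ with vertex set $V_{\Gamma_0}$ let $A^\mu_{-\Gamma_0}$ be the matrix indexed by $V_{\Gamma_0}$ with entries $-\sigma_{ij}w_{ij}/\mu_i$ if $\{i,j\}$ is an edge of $\Gamma_0$ and $0$ otherwise; its eigenvalues are real and are written $\lambda_1\le\lambda_2\le\cdots\le\lambda_{|V_{\Gamma_0}|}$. Let $\mathcal G$ be the set of subgraphs of $\Gamma$, $\mathcal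 C=\max_{i\in V}|\kappa_i/\mu_i|$ and $\mathcal S_p=\{f:V\to\mathbb R:\sum_i\mu_i|f(i)|^p=1\}$. 1. For every even $p\ge2$ the tensor $\mathcal A^{(p)}$ is symmetric, $\Delta_p^\sigma f=\mathcal A^{(p)}f^{p-1}$ for all $f:V\to\mathbb R$, and the eigenpairs of $\Delta_p^\sigma$ are exactly the eigenpairs of $\mathcal A$. 2. For every even $p\ge2$ the tensor $\mathcal A$ has a largest eigenvalue $\eta^{(p)}$, and $$\eta^{(p)}\ \ge\ 2^{p-1}\max_{\Gamma_0\in\mathcal G}\lambda_{|V_{\Gamma_0}|}(A^\mu_{-\Gamma_0})-\mathcal C\ =\ 2^{p-1}\max_{\substack{\Gamma_0\in\mathcal G\\|V_{\Gamma_0}|=n}}\lambda_n(A^\mu_{-\Gamma_0})-\mathcal C .$$ 3. Suppose moreover that $G$ is connected and $\sigma\equiv-1$. Then there is an eigenvector $f$ of $A^\mu_{-\Gamma}$ with eigenvalue $\lambda_n(A^\mu_{-\Gamma})$ such that, for every choice, for each even $p\ge2$, of an eigenvector $f^{(p)}\in\mathcal S_p$ of $\mathcal A$ with eigenvalue $\eta^{(p)}$,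 $$\lim_{p\to\infty,\ p\text{ even}}|f^{(p)}(i)|^{p/2}=f(i)\qquad\text{for all } i\in V .$$ -/

import Mathlib

open Filter Topology
open scoped Classical

noncomputable section

/-- A signed graph on the vertex set `V` (a simple graph with a signature on its edges), together
with a positive vertex measure, a positive edge weight and a real potential function. The
signature and the weight are functions of unordered pairs; only their values on edges matter. -/
structure SignedGraph (V : Type*) where
  graph : SimpleGraph V
  sign : Sym2 V → ℤˣ
  weight : Sym2 V → ℝ
  weight_pos : ∀ e ∈ graph.edgeSet, 0 < weight e
  measure : V → ℝ
  measure_pos : ∀ i, 0 < measure i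
  potential : V → ℝ

namespace SignedGraph

variable {V : Type*}

/-- `σ_{ij}` as a real number. -/
def sgn (Γ : SignedGraph V) (i j : V) : ℝ := ((Γ.sign s(i, j) : ℤ) : ℝ)

/-- `w_{ij}`. -/
def wt (Γ : SignedGraph V) (i j : V) : ℝ := Γ.weight s(i, j)

/-- The negation `-Γ`: all signs are reversed, all other data are kept. -/
def neg (Γ : SignedGraph V) : SignedGraph V where
  graph := Γ.graph
  sign := fun e => -Γ.sign e
  weight := Γ.weight
  weight_pos := Γ.weight_pos
  measure := Γ.measure
  measure_pos := Γ.measure_pos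
  potential := Γ.potential

/-- A subgraph (a subset of the vertices and a subset of the edges between them), with the
restricted signature, weight, measure and potential, as a signed graph. -/
def restrict (Γ : SignedGraph V) (H : Γ.graph.Subgraph) : SignedGraph H.verts where
  graph := H.coe
  sign := fun e => Γ.sign (e.map Subtype.val)
  weight := fun e => Γ.weight (e.map Subtype.val)
  weight_pos := by
    intro e
    induction e using Sym2.ind with
    | _ a b => exact fun h => Γ.weight_pos _ (H.adj_sub h)
  measure := fun i => Γ.measure i
  measure_pos := fun i => Γ.measure_pos i
  potential := fun i => Γ.potential i

/-- The signature is identically `-1`. -/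
def AllNegative (Γ : SignedGraph V) : Prop := ∀ e ∈ Γ.graph.edgeSet, Γ.sign e = -1

/-- The adjacency matrix `A_Γ`, with entries `σ_{ij} w_{ij}` on edges and `0` elsewhere. -/
def adjMatrix (Γ : SignedGraph V) : Matrix V V ℝ :=
  Matrix.of fun i j => if Γ.graph.Adj i j then Γ.sgn i j * Γ.wt i j else 0

/-- The normalized adjacency matrix `D⁻¹ A_Γ`, where `D` is diagonal with entries `μ_i`. -/
def normAdjMatrix (Γ : SignedGraph V) : Matrix V V ℝ :=
  Matrix.of fun i j => (Γ.measure i)⁻¹ * Γ.adjMatrix i j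

end SignedGraph

/-- `λ_k(M)`, `1 ≤ k ≤ n`: the `k`-th entry of the list of eigenvalues of the `n × n` matrix `M`
in increasing order and with multiplicity (the real roots of the characteristic polynomial; the
notion is used only for matrices `D⁻¹ A` as above, which are similar to the symmetric matrices
`D^{-1/2} A D^{-1/2}`, so that all `n` eigenvalues are real). -/
def matrixEigenvalue {V : Type*} [Fintype V] (M : Matrix V V ℝ) (k : ℕ) : ℝ :=
  (M.charpoly.roots.sort (· ≤ ·)).getD (k - 1) 0

/-- An `m`-th order tensor with indices in `V`. -/
abbrev IndexedTensor (V : Type*) (m : ℕ) : Type _ := (Fin m → V) → ℝ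

namespace IndexedTensor

variable {V : Type*} {m : ℕ}

/-- The entries are invariant under permutations of the indices. -/
def IsSymmetric (T : IndexedTensor V m) : Prop :=
  ∀ (π : Equiv.Perm (Fin m)) (I : Fin m → V), T (I ∘ π) = T I

/-- The index tuple `(i, J_1, …, J_{m-1})`. -/
def consIndex (i : V) (J : Fin (m - 1) → V) : Fin m → V :=
  fun k => if h : k.val = 0 then i else J ⟨k.val - 1, by omega⟩

/-- `(T x^{m-1})_i = ∑_{i_2, …, i_m} T_{i, i_2, …, i_m} x_{i_2} ⋯ x_{i_m}`. -/
def apply [Fintype V] (T : IndexedTensor V m) (x : V → ℝ) (i : V) : ℝ :=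
  ∑ J : Fin (m - 1) → V, T (consIndex i J) * ∏ k, x (J k)

/-- `x` is an eigenvector of the tensor with eigenvalue `lam`. -/
def IsEigenpair [Fintype V] (T : IndexedTensor V m) (lam : ℝ) (x : V → ℝ) : Prop :=
  x ≠ 0 ∧ ∀ i, T.apply x i = lam * x i ^ (m - 1)

/-- The set of eigenvalues of the tensor. -/
def eigenvalues [Fintype V] (T : IndexedTensor V m) : Set ℝ := {lam | ∃ x, T.IsEigenpair lam x}

end IndexedTensor

/-- `Ψ_p(t) = |t|^{p-2} t` for `t ≠ 0` and `Ψ_p(0) = 0`. -/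
def pPsi (p : ℝ) (t : ℝ) : ℝ := if t = 0 then 0 else |t| ^ (p - 2) * t

namespace SignedGraph

variable {V : Type*} [Fintype V]

/-- The signed `p`-Laplacian. -/
def pLaplacian (Γ : SignedGraph V) (p : ℝ) (f : V → ℝ) (i : V) : ℝ :=
  ∑ j with Γ.graph.Adj i j, Γ.wt i j * pPsi p (f i - Γ.sgn i j * f j)
    + Γ.potential i * pPsi p (f i)

/-- `(lam, f)` is an eigenpair of the signed `p`-Laplacian. -/
def IsLaplacianEigenpair (Γ : SignedGraph V) (p lam : ℝ) (f : V → ℝ) : Prop :=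
  f ≠ 0 ∧ ∀ i, Γ.pLaplacian p f i = lam * Γ.measure i * pPsi p (f i)

/-- The unit sphere `S_p` of `ℓ^p(μ)`. -/
def unitSphere (Γ : SignedGraph V) (p : ℝ) : Set (V → ℝ) :=
  {f | ∑ i, Γ.measure i * |f i| ^ p = 1}

/-- The tensor `A^{(p)}`. With `i` the first index, the entry is `κ_i + ∑_{j ∼ i} w_{ij}` if all
indices are equal to `i`, it is `(-σ_{ij})^l w_{ij}` if the indices are `l` copies of `i` and
`p - l` copies of a neighbour `j ≠ i`, and `0` in all other cases. (Since `i` is not its own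
neighbour, at most one `j` contributes to the second sum.) -/
def laplacianTensor (Γ : SignedGraph V) (p : ℕ) [NeZero p] : IndexedTensor V p := fun I =>
  if ∀ k, I k = I 0 then
    Γ.potential (I 0) + ∑ j with Γ.graph.Adj (I 0) j, Γ.wt (I 0) j
  else
    ∑ j with Γ.graph.Adj (I 0) j ∧ Set.range I = {I 0, j},
      (-Γ.sgn (I 0) j) ^ (Finset.card {k | I k = I 0}) * Γ.wt (I 0) j

/-- The `μ`-normalized tensor, with entries `A^{(p)}_{i_1, …, i_p} / μ_{i_1}`. -/
def normTensor (Γ : SignedGraph V) (p : ℕ) [NeZero p] : IndexedTensor V p := fun I =>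
  1 / Γ.measure (I 0) * Γ.laplacianTensor p I

/-- `max_i |κ_i / μ_i|`. -/
def potentialBound [Nonempty V] (Γ : SignedGraph V) : ℝ :=
  Finset.univ.sup' Finset.univ_nonempty fun i => |Γ.potential i / Γ.measure i|

/-- `λ_n(A^μ_{-Γ})`, where `n` is the number of vertices of `Γ`. -/
def topNegEigenvalue (Γ : SignedGraph V) : ℝ :=
  matrixEigenvalue Γ.neg.normAdjMatrix (Fintype.card V)

end SignedGraph

end

/-! The signed `p`-Laplacian is the gradient, up to the factor `p`, of the `p`-homogeneous function
`energy`; the eigenvalue problem is the critical point problem for `energy / mass`. For even `p` the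
row of the tensor at `i` is a combination of rank-one tensors, one for each term `(f i - σ f j) ^ (p
- 1)` and one for the potential (`laplacianTensor_consIndex`); this identifies tensor and operator.
A maximum of the quotient exists by compactness, is an eigenvalue by differentiation, and dominates
all eigenvalues.

For the lower bound, a top eigenvector of a negated subgraph is extended by zero and its signed
`p/2`-th root is inserted into `energy`. The arithmetic-geometric mean inequality `4ab ≤ (a + b)²`,
raised to the power `p/2`, compares each edge term with the quadratic form
(`two_pow_mul_le_oddRoot_add_pow`). Extension by zero also shows that spanning subgraphs suffice for
the maximum.

For the limit, put `h_p = |f^{(p)}|^{p/2}`, a point of the nonnegative `ℓ²(μ)` sphere. The lower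
bound and the triangle inequality on edges show that a weighted sum of squared power means of
exponent `2/p` at `h_p` is at least `λ_n - o(1)`. These means decrease to the geometric mean as `p →
∞`, so every cluster point of `h_p` maximizes the adjacency form. By Perron-Frobenius the
nonnegative normalized maximizer is unique, and compactness gives convergence. -/

section MatrixEigenvalue

/-! ### The largest eigenvalue as a root of the characteristic polynomial -/

variable {W : Type*} [Fintype W]

theorem isGreatest_matrixEigenvalue_card [Nonempty W] {M S : Matrix W W ℝ} (hS : S.IsHermitian)
    (h : M.charpoly = S.charpoly) :
    IsGreatest {x | x ∈ M.charpoly.roots} (matrixEigenvalue M (Fintype.card W)) := by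
  have hcard : Multiset.card M.charpoly.roots = Fintype.card W := by
    rw [h, hS.roots_charpoly_eq_eigenvalues]; simp
  have hpos : 0 < Fintype.card W := Fintype.card_pos
  set L := M.charpoly.roots.sort (· ≤ ·) with hL
  have hlen : L.length = Fintype.card W := by rw [hL, Multiset.length_sort, hcard]
  -- All `n` roots are real because `S` is Hermitian, so the last position `n - 1` is in range and
  -- the default value of `getD` never occurs.
  have hlt : Fintype.card W - 1 < L.length := by omega
  have hval : matrixEigenvalue M (Fintype.card W) = L[Fintype.card W - 1] := by
    unfold matrixEigenvalue
    rw [← hL, List.getD_eq_getElem _ _ hlt]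
  rw [hval]
  constructor
  · change _ ∈ M.charpoly.roots
    rw [← Multiset.mem_sort (r := (· ≤ ·))]
    exact List.getElem_mem hlt
  · intro x hx
    change x ∈ M.charpoly.roots at hx
    rw [← Multiset.mem_sort (r := (· ≤ ·))] at hx
    obtain ⟨k, hk, rfl⟩ := List.getElem_of_mem hx
    have hpw := Multiset.pairwise_sort M.charpoly.roots (· ≤ ·)
    rw [← hL] at hk
    rcases (show k ≤ Fintype.card W - 1 by omega).eq_or_lt with h' | h'
    · subst h'; rfl
    · exact List.pairwise_iff_getElem.1 hpw _ _ hk hlt h'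

open scoped Pointwise in
-- The spectrum of `c - S` is `c` minus the spectrum of `S`, hence nonnegative.
theorem posSemidef_smul_one_sub {S : Matrix W W ℝ} (hS : S.IsHermitian) {c : ℝ}
    (hc : ∀ x ∈ S.charpoly.roots, x ≤ c) : (c • (1 : Matrix W W ℝ) - S).PosSemidef := by
  have hH : (c • (1 : Matrix W W ℝ) - S).IsHermitian := by
    refine Matrix.IsHermitian.sub ?_ hS
    rw [Matrix.IsHermitian, Matrix.conjTranspose_smul, Matrix.conjTranspose_one]; simp
  rw [hH.posSemidef_iff_eigenvalues_nonneg]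
  intro i
  have h1 := hH.eigenvalues_mem_spectrum_real i
  have h2 : hH.eigenvalues i ∈ ({c} : Set ℝ) - spectrum ℝ S := by
    rw [spectrum.singleton_sub_eq, Algebra.algebraMap_eq_smul_one]; exact h1
  obtain ⟨a, ha, b, hb, hab⟩ := Set.mem_sub.1 h2
  have ha' : a = c := ha
  rw [Matrix.mem_spectrum_iff_isRoot_charpoly] at hb
  have := hc b ((Polynomial.mem_roots S.charpoly_monic.ne_zero).2 hb)
  rw [Pi.zero_apply, ← hab]; linarith

theorem exists_mulVec_eq_smul_of_mem_roots {M : Matrix W W ℝ} {c : ℝ}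
    (hc : c ∈ M.charpoly.roots) : ∃ g : W → ℝ, g ≠ 0 ∧ M.mulVec g = c • g := by
  have h := (Polynomial.mem_roots M.charpoly_monic.ne_zero).1 hc
  rw [Polynomial.IsRoot, Matrix.eval_charpoly] at h
  obtain ⟨g, hg, hg'⟩ := Matrix.exists_mulVec_eq_zero_iff.2 h
  refine ⟨g, hg, ?_⟩
  rw [Matrix.sub_mulVec, sub_eq_zero] at hg'
  rw [← hg']
  ext i
  simp [Matrix.scalar_apply, Matrix.mulVec_diagonal]

end MatrixEigenvalue

/-! ### Rayleigh quotients of the normalized adjacency matrix -/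

namespace SignedGraph

section Spectral

variable {W : Type*}

theorem sgn_comm (Γ : SignedGraph W) (i j : W) : Γ.sgn i j = Γ.sgn j i := by
  unfold sgn; rw [Sym2.eq_swap]

theorem wt_comm (Γ : SignedGraph W) (i j : W) : Γ.wt i j = Γ.wt j i := by
  unfold wt; rw [Sym2.eq_swap]

theorem wt_pos (Γ : SignedGraph W) {i j : W} (h : Γ.graph.Adj i j) : 0 < Γ.wt i j :=
  Γ.weight_pos _ h

theorem sgn_eq (Γ : SignedGraph W) (i j : W) : Γ.sgn i j = 1 ∨ Γ.sgn i j = -1 := by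
  unfold sgn
  rcases Int.units_eq_one_or (Γ.sign s(i, j)) with h | h <;> simp [h]

theorem adjMatrix_comm (Γ : SignedGraph W) (i j : W) : Γ.adjMatrix i j = Γ.adjMatrix j i := by
  simp only [adjMatrix, Matrix.of_apply, Γ.graph.adj_comm i j, Γ.sgn_comm i j, Γ.wt_comm i j]

variable [Fintype W]

/-- The quadratic form of the adjacency matrix. -/
noncomputable def adjForm (Γ : SignedGraph W) (g : W → ℝ) : ℝ :=
  ∑ i, ∑ j, Γ.adjMatrix i j * (g i * g j)

/-- The largest eigenvalue of the normalized adjacency matrix. -/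
noncomputable def topEigenvalue (Γ : SignedGraph W) : ℝ :=
  matrixEigenvalue Γ.normAdjMatrix (Fintype.card W)

theorem mulVec_normAdjMatrix (Γ : SignedGraph W) (g : W → ℝ) (i : W) :
    Γ.normAdjMatrix.mulVec g i = (Γ.measure i)⁻¹ * ∑ j, Γ.adjMatrix i j * g j := by
  simp only [Matrix.mulVec, dotProduct, normAdjMatrix, Matrix.of_apply, Finset.mul_sum, mul_assoc]

theorem normAdjMatrix_mulVec_eq_iff (Γ : SignedGraph W) (g : W → ℝ) (c : ℝ) :
    Γ.normAdjMatrix.mulVec g = c • g ↔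
      ∀ i, ∑ j, Γ.adjMatrix i j * g j = c * (Γ.measure i * g i) := by
  rw [funext_iff]
  refine forall_congr' fun i => ?_
  have := (Γ.measure_pos i).ne'
  rw [mulVec_normAdjMatrix, Pi.smul_apply, smul_eq_mul]
  field_simp

/-- The symmetric matrix similar to the normalized adjacency matrix. -/
noncomputable def symmAdjMatrix (Γ : SignedGraph W) : Matrix W W ℝ :=
  Matrix.diagonal (fun i => (√(Γ.measure i))⁻¹) * Γ.adjMatrix *
    Matrix.diagonal (fun i => (√(Γ.measure i))⁻¹)

theorem isHermitian_symmAdjMatrix (Γ : SignedGraph W) : Γ.symmAdjMatrix.IsHermitian := by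
  ext i j
  simp only [symmAdjMatrix, Matrix.conjTranspose_apply, Matrix.mul_diagonal,
    Matrix.diagonal_mul, star_trivial]
  rw [Γ.adjMatrix_comm]; ring

/-- `XY` and `YX` have the same characteristic polynomial; moving one factor `D^{-1/2}` across gives
`D⁻¹ A`. -/
theorem charpoly_normAdjMatrix (Γ : SignedGraph W) :
    Γ.normAdjMatrix.charpoly = Γ.symmAdjMatrix.charpoly := by
  rw [symmAdjMatrix, Matrix.charpoly_mul_comm, ← Matrix.mul_assoc, Matrix.diagonal_mul_diagonal]
  congr 1
  ext i j
  rw [Matrix.diagonal_mul, normAdjMatrix, Matrix.of_apply, ← mul_inv,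
    Real.mul_self_sqrt (Γ.measure_pos i).le]

/-- Conjugating `λ - D^{-1/2} A D^{-1/2} ≥ 0` by `D^{1/2}` gives `λ D - A ≥ 0`. -/
theorem posSemidef_topEigenvalue (Γ : SignedGraph W) [Nonempty W] :
    (Γ.topEigenvalue • Matrix.diagonal Γ.measure - Γ.adjMatrix).PosSemidef := by
  have h := posSemidef_smul_one_sub Γ.isHermitian_symmAdjMatrix (c := Γ.topEigenvalue) (by
    rw [← charpoly_normAdjMatrix]
    exact (isGreatest_matrixEigenvalue_card Γ.isHermitian_symmAdjMatrix
      Γ.charpoly_normAdjMatrix).2)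
  convert h.conjTranspose_mul_mul_same (Matrix.diagonal fun i => √(Γ.measure i)) using 1
  ext i j
  have hi := (Real.sqrt_pos.2 (Γ.measure_pos i)).ne'
  have hj := (Real.sqrt_pos.2 (Γ.measure_pos j)).ne'
  have hs := Real.mul_self_sqrt (Γ.measure_pos i).le
  simp only [symmAdjMatrix, Matrix.diagonal_conjTranspose, star_trivial, Matrix.mul_diagonal,
    Matrix.diagonal_mul, Matrix.sub_apply, Matrix.smul_apply, Matrix.one_apply,
    Matrix.diagonal_apply, smul_eq_mul]
  by_cases hij : i = j
  · subst hij
    simp only [if_true]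
    field_simp
    rw [Real.sq_sqrt (Γ.measure_pos i).le]
  · simp only [if_neg hij]
    field_simp
    ring

theorem topEigenvalue_sub_mulVec (Γ : SignedGraph W) (g : W → ℝ) (i : W) :
    (Γ.topEigenvalue • Matrix.diagonal Γ.measure - Γ.adjMatrix).mulVec g i =
      Γ.topEigenvalue * (Γ.measure i * g i) - ∑ j, Γ.adjMatrix i j * g j := by
  rw [Matrix.sub_mulVec, Pi.sub_apply, Matrix.smul_mulVec, Pi.smul_apply, Matrix.mulVec_diagonal,
    smul_eq_mul]
  rfl

theorem dotProduct_topEigenvalue (Γ : SignedGraph W) (g : W → ℝ) :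
    star g ⬝ᵥ (Γ.topEigenvalue • Matrix.diagonal Γ.measure - Γ.adjMatrix).mulVec g =
      Γ.topEigenvalue * ∑ i, Γ.measure i * g i ^ 2 - Γ.adjForm g := by
  simp only [dotProduct, topEigenvalue_sub_mulVec, star_trivial, adjForm, mul_sub,
    Finset.sum_sub_distrib, Finset.mul_sum]
  congr 1
  · exact Finset.sum_congr rfl fun i _ => by ring
  · exact Finset.sum_congr rfl fun i _ => Finset.sum_congr rfl fun j _ => by ring

theorem adjForm_le (Γ : SignedGraph W) [Nonempty W] (g : W → ℝ) :
    Γ.adjForm g ≤ Γ.topEigenvalue * ∑ i, Γ.measure i * g i ^ 2 := by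
  have h := Γ.posSemidef_topEigenvalue.dotProduct_mulVec_nonneg g
  rw [dotProduct_topEigenvalue] at h
  linarith

/-- A vector on which a positive semidefinite form vanishes lies in its kernel, so maximizers of the
Rayleigh quotient are eigenvectors. -/
theorem mulVec_eq_of_le_adjForm (Γ : SignedGraph W) [Nonempty W] {g : W → ℝ}
    (hg : Γ.topEigenvalue * ∑ i, Γ.measure i * g i ^ 2 ≤ Γ.adjForm g) :
    Γ.normAdjMatrix.mulVec g = Γ.topEigenvalue • g := by
  have h := (Γ.posSemidef_topEigenvalue.dotProduct_mulVec_zero_iff g).1 (by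
    rw [dotProduct_topEigenvalue]; linarith [Γ.adjForm_le g])
  rw [normAdjMatrix_mulVec_eq_iff]
  intro i
  have h' := congrFun h i
  rw [topEigenvalue_sub_mulVec, Pi.zero_apply] at h'
  linarith

theorem adjForm_eq_of_mulVec_eq (Γ : SignedGraph W) {g : W → ℝ} {c : ℝ}
    (hg : Γ.normAdjMatrix.mulVec g = c • g) :
    Γ.adjForm g = c * ∑ i, Γ.measure i * g i ^ 2 := by
  rw [normAdjMatrix_mulVec_eq_iff] at hg
  rw [adjForm, Finset.mul_sum]
  refine Finset.sum_congr rfl fun i _ => ?_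
  calc ∑ j, Γ.adjMatrix i j * (g i * g j) = g i * ∑ j, Γ.adjMatrix i j * g j := by
        rw [Finset.mul_sum]; exact Finset.sum_congr rfl fun j _ => by ring
    _ = _ := by rw [hg]; ring

theorem exists_topEigenvector (Γ : SignedGraph W) [Nonempty W] :
    ∃ g : W → ℝ, g ≠ 0 ∧ Γ.normAdjMatrix.mulVec g = Γ.topEigenvalue • g :=
  exists_mulVec_eq_smul_of_mem_roots
    (isGreatest_matrixEigenvalue_card Γ.isHermitian_symmAdjMatrix Γ.charpoly_normAdjMatrix).1

theorem sum_measure_mul_sq_pos (Γ : SignedGraph W) {g : W → ℝ} (hg : g ≠ 0) :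
    0 < ∑ i, Γ.measure i * g i ^ 2 := by
  obtain ⟨i, hi⟩ := Function.ne_iff.1 hg
  exact Finset.sum_pos' (fun i _ => mul_nonneg (Γ.measure_pos i).le (sq_nonneg _))
    ⟨i, Finset.mem_univ _, mul_pos (Γ.measure_pos i) (by simpa using sq_pos_of_ne_zero hi)⟩

end Spectral

end SignedGraph

/-! ### The tensor of the `p`-Laplacian for even `p` -/

theorem pPsi_natCast_of_even {p : ℕ} [NeZero p] (hp : Even p) (t : ℝ) :
    pPsi p t = t ^ (p - 1) := by
  have h0 := NeZero.ne p
  obtain ⟨m, rfl⟩ := hp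
  unfold pPsi
  split_ifs with h
  · rw [h, zero_pow (by omega)]
  · have h1 : ((m + m : ℕ) : ℝ) - 2 = ((2 * (m - 1) : ℕ) : ℝ) := by
      obtain ⟨k, rfl⟩ : ∃ k, m = k + 1 := ⟨m - 1, by omega⟩
      push_cast [Nat.add_sub_cancel]; ring
    rw [h1, Real.rpow_natCast, pow_mul, sq_abs, ← pow_mul, ← pow_succ]
    congr 1; omega

namespace SignedGraph

variable {V : Type*} [Fintype V]

omit [Fintype V] in
-- Since `p` is even, `a` and `b` have the same parity, and `(-σ)² = 1`. This lets copies of `i` be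
-- counted as copies of `j`.
theorem neg_sgn_pow_eq (Γ : SignedGraph V) (i j : V) {p a b : ℕ} (hp : Even p) (h : a + b = p) :
    (-Γ.sgn i j) ^ a = (-Γ.sgn i j) ^ b := by
  have hs : (-Γ.sgn i j) ^ 2 = 1 := by rcases Γ.sgn_eq i j with h | h <;> simp [h]
  have hpar : Even a ↔ Even b := by rw [← Nat.even_add, h]; exact hp
  by_cases ha : Even a
  · obtain ⟨c, hc⟩ := even_iff_two_dvd.1 ha
    obtain ⟨d, hd⟩ := even_iff_two_dvd.1 (hpar.1 ha)
    rw [hc, hd, pow_mul, pow_mul, hs, one_pow, one_pow]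
  · obtain ⟨c, hc⟩ := Nat.not_even_iff_odd.1 ha
    obtain ⟨d, hd⟩ := Nat.not_even_iff_odd.1 (fun h => ha (hpar.2 h))
    rw [hc, hd, pow_succ, pow_succ, pow_mul, pow_mul, hs, one_pow, one_pow]

theorem laplacianTensor_of_range_eq (Γ : SignedGraph V) {p : ℕ} [NeZero p] {I : Fin p → V} {j : V}
    (hj : j ≠ I 0) (h : Set.range I = {I 0, j}) :
    Γ.laplacianTensor p I = if Γ.graph.Adj (I 0) j then
      (-Γ.sgn (I 0) j) ^ (Finset.card {k | I k = I 0}) * Γ.wt (I 0) j else 0 := by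
  have hne : ¬ ∀ k, I k = I 0 := by
    intro hk
    have : j ∈ Set.range I := by rw [h]; simp
    obtain ⟨k, rfl⟩ := this
    exact hj (hk k)
  rw [laplacianTensor, if_neg hne]
  have hu : ∀ x, Γ.graph.Adj (I 0) x ∧ Set.range I = {I 0, x} ↔ x = j ∧ Γ.graph.Adj (I 0) j := by
    intro x
    constructor
    · rintro ⟨ha, hx⟩
      have : j ∈ Set.range I := by rw [h]; simp
      rw [hx] at this
      rcases this with h' | h'
      · exact absurd h' hj
      · rw [Set.mem_singleton_iff.1 h']; exact ⟨rfl, ha⟩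
    · rintro ⟨rfl, ha⟩; exact ⟨ha, h⟩
  simp only [hu]
  split_ifs with ha
  · simp [ha, Finset.sum_filter]
  · simp [ha]

theorem laplacianTensor_eq_zero (Γ : SignedGraph V) {p : ℕ} [NeZero p] {I : Fin p → V}
    (h : ∀ j, j ≠ I 0 → Set.range I ≠ {I 0, j}) (hc : ¬ ∀ k, I k = I 0) :
    Γ.laplacianTensor p I = 0 := by
  rw [laplacianTensor, if_neg hc]
  refine Finset.sum_eq_zero fun j hj => ?_
  rw [Finset.mem_filter] at hj
  exact absurd hj.2.2 (h j hj.2.1.ne')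

/-- A permutation keeps the range and the multiplicities of the indices. Only the leading index can
change, from `i` to `j`, which turns the exponent `l` into `p - l`; `neg_sgn_pow_eq` absorbs this.
-/
theorem isSymmetric_laplacianTensor (Γ : SignedGraph V) {p : ℕ} [NeZero p] (hp : Even p) :
    (Γ.laplacianTensor p).IsSymmetric := by
  intro π I
  have hrange : Set.range (I ∘ π) = Set.range I := π.surjective.range_comp I
  have hmem : (I ∘ π) 0 ∈ Set.range I := ⟨π 0, rfl⟩
  have hcount : ∀ a, Finset.card {k | (I ∘ π) k = a} = Finset.card {k | I k = a} := by
    intro a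
    refine Finset.card_bij (fun k _ => π k) (by simp) (by simp) fun k hk => ⟨π.symm k, ?_⟩
    simpa using hk
  by_cases hc : ∀ k, I k = I 0
  · have hc' : I ∘ π = I := by
      ext k; simp only [Function.comp]; rw [hc (π k), hc k]
    rw [hc']
  by_cases hj : ∃ j, j ≠ I 0 ∧ Set.range I = {I 0, j}
  · obtain ⟨j, hj, hr⟩ := hj
    have hm := hmem
    rw [hr] at hm
    rw [laplacianTensor_of_range_eq Γ hj hr]
    rcases hm with h0 | h0
    · rw [laplacianTensor_of_range_eq Γ (j := j) (by rwa [h0]) (by rw [hrange, hr, h0]), h0, hcount]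
    · have h0 : (I ∘ π) 0 = j := h0
      rw [laplacianTensor_of_range_eq Γ (j := I 0) (by rw [h0]; exact hj.symm)
        (by rw [hrange, hr, h0, Set.pair_comm]), h0, hcount, Γ.graph.adj_comm, Γ.sgn_comm,
        Γ.wt_comm]
      congr 2
      refine neg_sgn_pow_eq Γ _ _ hp ?_
      have hnot : ∀ k, I k = I 0 ↔ ¬ I k = j := by
        intro k
        have : I k ∈ Set.range I := ⟨k, rfl⟩
        rw [hr] at this
        rcases this with h | h
        · rw [h]; simpa using hj.symm
        · rw [Set.mem_singleton_iff.1 h]; simpa using hj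
      simp only [hnot]
      rw [Finset.card_filter_add_card_filter_not]
      simp
  · push Not at hj
    rw [laplacianTensor_eq_zero Γ hj hc]
    refine laplacianTensor_eq_zero Γ ?_ ?_
    · intro j hj' hr
      rw [hrange] at hr
      have h0 : I 0 ∈ Set.range I := ⟨0, rfl⟩
      rw [hr] at h0
      rcases h0 with h0 | h0
      · exact hj j (by rwa [h0]) (by rw [hr, h0])
      · have h0 : I 0 = j := h0
        exact hj ((I ∘ π) 0) (by rw [h0]; exact hj'.symm) (by rw [hr, h0, Set.pair_comm])
    · intro hk
      apply hc
      have : ∀ k, I k = (I ∘ π) 0 := fun k => by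
        rw [← hk (π.symm k)]; simp
      intro k; rw [this k, this 0]

omit [Fintype V] in
theorem consIndex_zero {p : ℕ} [NeZero p] (i : V) (J : Fin (p - 1) → V) :
    IndexedTensor.consIndex i J 0 = i := by
  simp [IndexedTensor.consIndex]

/-- The coefficients of the linear form `f ↦ f i - σ_{ij} f j`. -/
noncomputable def diffCoeff (Γ : SignedGraph V) (i j v : V) : ℝ :=
  if v = i then 1 else if v = j then -Γ.sgn i j else 0

theorem sum_diffCoeff_mul (Γ : SignedGraph V) {i j : V} (h : i ≠ j) (f : V → ℝ) :
    ∑ v, Γ.diffCoeff i j v * f v = f i - Γ.sgn i j * f j := by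
  have : ∀ v, Γ.diffCoeff i j v * f v =
      (if v = i then f i else 0) + if v = j then -Γ.sgn i j * f j else 0 := by
    intro v
    unfold diffCoeff
    by_cases hi : v = i
    · subst hi; simp [h]
    · by_cases hj : v = j
      · subst hj; simp [hi]
      · simp [hi, hj]
  simp only [this, Finset.sum_add_distrib]
  simp; ring

omit [Fintype V] in
theorem prod_diffCoeff (Γ : SignedGraph V) {i j : V} (h : i ≠ j) {q : ℕ} (J : Fin q → V) :
    ∏ k, Γ.diffCoeff i j (J k) =
      if ∀ k, J k = i ∨ J k = j then (-Γ.sgn i j) ^ (Finset.card {k | J k = j}) else 0 := by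
  split_ifs with hJ
  · rw [← Finset.prod_const, Finset.prod_filter]
    refine Finset.prod_congr rfl fun k _ => ?_
    unfold diffCoeff
    rcases hJ k with hk | hk <;> simp [hk, h, h.symm]
  · push Not at hJ
    obtain ⟨k, hk⟩ := hJ
    exact Finset.prod_eq_zero (Finset.mem_univ k) (by simp [diffCoeff, hk])

omit [Fintype V] in
theorem forall_fin_iff_consIndex {p : ℕ} [NeZero p] (i : V) (J : Fin (p - 1) → V) {P : V → Prop} :
    (∀ k, P (IndexedTensor.consIndex i J k)) ↔ P i ∧ ∀ k, P (J k) := by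
  constructor
  · intro h
    refine ⟨by simpa [consIndex_zero] using h 0, fun k => ?_⟩
    simpa [IndexedTensor.consIndex] using h ⟨k.val + 1, by omega⟩
  · rintro ⟨h0, h⟩ k
    unfold IndexedTensor.consIndex
    split_ifs
    · exact h0
    · exact h _

omit [Fintype V] in
theorem card_consIndex_eq {p : ℕ} [NeZero p] {i j : V} (h : j ≠ i) (J : Fin (p - 1) → V) :
    Finset.card {k | IndexedTensor.consIndex i J k = j} = Finset.card {k | J k = j} := by
  symm
  refine Finset.card_bij (fun k _ => ⟨k.val + 1, by omega⟩) ?_ ?_ ?_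
  · intro k hk
    simpa [IndexedTensor.consIndex] using hk
  · intro a _ b _ hab
    ext; simpa using hab
  · intro k hk
    rw [Finset.mem_filter] at hk
    have hk' := hk.2
    unfold IndexedTensor.consIndex at hk'
    split_ifs at hk' with h0
    · exact absurd hk'.symm h
    · exact ⟨⟨k.val - 1, by omega⟩, by simpa using hk', by ext; simp; omega⟩

/-- For fixed first index the tensor is `κ_i e_i^{⊗(p-1)} + ∑_j w_{ij} (e_i - σ_{ij} e_j)^{⊗(p-1)}`,
whose action is a sum of powers of linear forms. -/
theorem laplacianTensor_consIndex (Γ : SignedGraph V) {p : ℕ} [NeZero p] (hp : Even p) (i : V)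
    (J : Fin (p - 1) → V) :
    Γ.laplacianTensor p (IndexedTensor.consIndex i J) =
      Γ.potential i * ∏ k, (if J k = i then (1 : ℝ) else 0) +
        ∑ j with Γ.graph.Adj i j, Γ.wt i j * ∏ k, Γ.diffCoeff i j (J k) := by
  have hp1 : 0 < p - 1 := by
    obtain ⟨m, hm⟩ := hp
    have := NeZero.ne p
    omega
  by_cases hJ : ∀ k, J k = i
  · have hc : ∀ k, IndexedTensor.consIndex i J k = IndexedTensor.consIndex i J 0 := by
      rw [consIndex_zero, forall_fin_iff_consIndex (P := fun v => v = i)]; exact ⟨rfl, hJ⟩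
    rw [laplacianTensor, if_pos hc, consIndex_zero]
    simp [hJ, diffCoeff]
  · have hc : ¬ ∀ k, IndexedTensor.consIndex i J k = IndexedTensor.consIndex i J 0 := by
      rw [consIndex_zero, forall_fin_iff_consIndex (P := fun v => v = i)]; exact fun h => hJ h.2
    have h0 : ∏ k, (if J k = i then (1 : ℝ) else 0) = 0 := by
      push Not at hJ
      obtain ⟨k, hk⟩ := hJ
      exact Finset.prod_eq_zero (Finset.mem_univ k) (by simp [hk])
    rw [laplacianTensor, if_neg hc, consIndex_zero, h0, mul_zero, zero_add, ← Finset.filter_filter,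
      Finset.sum_filter]
    refine Finset.sum_congr rfl fun j hj => ?_
    have hij : i ≠ j := (Finset.mem_filter.1 hj).2.ne
    rw [prod_diffCoeff Γ hij]
    have hr : Set.range (IndexedTensor.consIndex i J) = {i, j} ↔ ∀ k, J k = i ∨ J k = j := by
      constructor
      · intro h
        refine ((forall_fin_iff_consIndex i J (P := fun v => v = i ∨ v = j)).1 fun k => ?_).2
        have : IndexedTensor.consIndex i J k ∈ Set.range (IndexedTensor.consIndex i J) := ⟨k, rfl⟩
        rw [h] at this
        simpa using this
      · intro h
        apply Set.Subset.antisymm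
        · rintro _ ⟨k, rfl⟩
          exact (forall_fin_iff_consIndex i J (P := fun v => v = i ∨ v = j)).2 ⟨Or.inl rfl, h⟩ k
        · rintro v (rfl | hv)
          · exact ⟨0, consIndex_zero _ _⟩
          · rw [Set.mem_singleton_iff.1 hv]
            push Not at hJ
            obtain ⟨k, hk⟩ := hJ
            refine ⟨⟨k.val + 1, by omega⟩, ?_⟩
            simpa [IndexedTensor.consIndex] using (h k).resolve_left hk
    simp only [hr]
    split_ifs with h
    · rw [mul_comm]
      congr 1
      -- The product of coefficients has the number of copies of `j` as exponent, the tensor the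
      -- number of copies of `i`; the two numbers add up to `p`.
      rw [← card_consIndex_eq hij.symm J]
      refine neg_sgn_pow_eq Γ _ _ hp ?_
      have hnot : ∀ k, IndexedTensor.consIndex i J k = j ↔
          ¬ IndexedTensor.consIndex i J k = i := by
        intro k
        rcases (forall_fin_iff_consIndex i J (P := fun v => v = i ∨ v = j)).2
          ⟨Or.inl rfl, h⟩ k with h | h <;> simp [h, hij, hij.symm]
      simp only [hnot]
      rw [Finset.card_filter_add_card_filter_not]
      simp
    · simp

theorem sum_prod_mul_prod {q : ℕ} (c f : V → ℝ) :
    ∑ J : Fin q → V, (∏ k, c (J k)) * ∏ k, f (J k) = (∑ v, c v * f v) ^ q := by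
  have h := Finset.prod_univ_sum (fun _ : Fin q => (Finset.univ : Finset V))
    (fun _ v => c v * f v)
  rw [Finset.prod_const, Finset.card_univ, Fintype.card_fin] at h
  rw [h, Fintype.piFinset_univ]
  exact Finset.sum_congr rfl fun J _ => Finset.prod_mul_distrib.symm

theorem laplacianTensor_apply (Γ : SignedGraph V) {p : ℕ} [NeZero p] (hp : Even p) (f : V → ℝ)
    (i : V) :
    (Γ.laplacianTensor p).apply f i =
      ∑ j with Γ.graph.Adj i j, Γ.wt i j * (f i - Γ.sgn i j * f j) ^ (p - 1) +
        Γ.potential i * f i ^ (p - 1) := by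
  unfold IndexedTensor.apply
  simp only [laplacianTensor_consIndex Γ hp, add_mul, Finset.sum_add_distrib, Finset.sum_mul]
  rw [add_comm, Finset.sum_comm]
  congr 1
  · refine Finset.sum_congr rfl fun j hj => ?_
    rw [← sum_diffCoeff_mul Γ (Finset.mem_filter.1 hj).2.ne, ← sum_prod_mul_prod, Finset.mul_sum]
    exact Finset.sum_congr rfl fun J _ => mul_assoc _ _ _
  · have := sum_prod_mul_prod (q := p - 1) (fun v => if v = i then (1 : ℝ) else 0) f
    simp only [ite_mul, one_mul, zero_mul, Finset.sum_ite_eq', Finset.mem_univ, if_true] at this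
    rw [← this, Finset.mul_sum]
    exact Finset.sum_congr rfl fun J _ => mul_assoc _ _ _

theorem pLaplacian_eq_apply (Γ : SignedGraph V) {p : ℕ} [NeZero p] (hp : Even p) (f : V → ℝ) :
    Γ.pLaplacian p f = (Γ.laplacianTensor p).apply f := by
  ext i
  simp only [laplacianTensor_apply Γ hp, pLaplacian, pPsi_natCast_of_even hp]

theorem normTensor_apply (Γ : SignedGraph V) {p : ℕ} [NeZero p] (f : V → ℝ) (i : V) :
    (Γ.normTensor p).apply f i = (Γ.measure i)⁻¹ * (Γ.laplacianTensor p).apply f i := by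
  simp only [IndexedTensor.apply, normTensor, consIndex_zero, Finset.mul_sum, one_div, mul_assoc]

theorem normTensor_isEigenpair_iff (Γ : SignedGraph V) {p : ℕ} [NeZero p] {c : ℝ} {f : V → ℝ} :
    (Γ.normTensor p).IsEigenpair c f ↔
      f ≠ 0 ∧ ∀ i, (Γ.laplacianTensor p).apply f i = c * Γ.measure i * f i ^ (p - 1) := by
  refine and_congr_right fun _ => forall_congr' fun i => ?_
  have := (Γ.measure_pos i).ne'
  rw [normTensor_apply]
  field_simp

theorem isLaplacianEigenpair_iff (Γ : SignedGraph V) {p : ℕ} [NeZero p] (hp : Even p) (c : ℝ)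
    (f : V → ℝ) : Γ.IsLaplacianEigenpair p c f ↔ (Γ.normTensor p).IsEigenpair c f := by
  rw [normTensor_isEigenpair_iff]
  simp only [IsLaplacianEigenpair, pLaplacian_eq_apply Γ hp, pPsi_natCast_of_even hp]

end SignedGraph

/-! ### Variational characterization of the largest tensor eigenvalue -/

namespace SignedGraph

variable {V : Type*} [Fintype V]

/-- The energy whose derivative is `p` times the `p`-Laplacian. -/
noncomputable def energy (Γ : SignedGraph V) (p : ℕ) (f : V → ℝ) : ℝ :=
  2⁻¹ * (∑ i, ∑ j with Γ.graph.Adj i j, Γ.wt i j * (f i - Γ.sgn i j * f j) ^ p) +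
    ∑ i, Γ.potential i * f i ^ p

/-- The `p`-th power of the `ℓ^p(μ)`-norm, for even `p`. -/
noncomputable def mass (Γ : SignedGraph V) (p : ℕ) (f : V → ℝ) : ℝ :=
  ∑ i, Γ.measure i * f i ^ p

theorem sum_adj_comm (Γ : SignedGraph V) (F : V → V → ℝ) :
    ∑ i, ∑ j with Γ.graph.Adj i j, F i j = ∑ i, ∑ j with Γ.graph.Adj i j, F j i := by
  simp only [Finset.sum_filter]
  rw [Finset.sum_comm]
  simp only [Γ.graph.adj_comm]

/-- The discrete Green formula. -/
theorem sum_mul_diff (Γ : SignedGraph V) {q : ℕ} (hq : Odd q) (f v : V → ℝ) :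
    ∑ i, ∑ j with Γ.graph.Adj i j,
        Γ.wt i j * ((f i - Γ.sgn i j * f j) ^ q * (v i - Γ.sgn i j * v j)) =
      2 * ∑ i, ∑ j with Γ.graph.Adj i j, v i * (Γ.wt i j * (f i - Γ.sgn i j * f j) ^ q) := by
  -- Exchanging `i` and `j` multiplies the difference by `-σ`, and so does its odd power since `σ =
  -- ±1`.
  have h : ∀ i j, Γ.wt j i * ((f j - Γ.sgn j i * f i) ^ q * v j) =
      Γ.wt i j * ((f i - Γ.sgn i j * f j) ^ q * (-Γ.sgn i j * v j)) := by
    intro i j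
    rw [Γ.wt_comm j i, Γ.sgn_comm j i]
    rcases Γ.sgn_eq i j with hs | hs <;> rw [hs]
    · have : f j - 1 * f i = -(f i - 1 * f j) := by ring
      rw [this, hq.neg_pow]; ring
    · have : f j - -1 * f i = f i - -1 * f j := by ring
      rw [this]; ring
  have h1 := (Γ.sum_adj_comm fun i j => Γ.wt i j * ((f i - Γ.sgn i j * f j) ^ q * v i)).trans
    (Finset.sum_congr rfl fun i _ => Finset.sum_congr rfl fun j _ => h i j)
  calc _ = (∑ i, ∑ j with Γ.graph.Adj i j, Γ.wt i j * ((f i - Γ.sgn i j * f j) ^ q * v i)) +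
        ∑ i, ∑ j with Γ.graph.Adj i j,
          Γ.wt i j * ((f i - Γ.sgn i j * f j) ^ q * (-Γ.sgn i j * v j)) := by
        simp only [← Finset.sum_add_distrib]
        exact Finset.sum_congr rfl fun i _ => Finset.sum_congr rfl fun j _ => by ring
    _ = 2 * ∑ i, ∑ j with Γ.graph.Adj i j, Γ.wt i j * ((f i - Γ.sgn i j * f j) ^ q * v i) := by
        rw [← h1]; ring
    _ = _ := by
        congr 1
        exact Finset.sum_congr rfl fun i _ => Finset.sum_congr rfl fun j _ => by ring

theorem sum_mul_apply (Γ : SignedGraph V) {p : ℕ} [NeZero p] (hp : Even p) (f v : V → ℝ) :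
    ∑ i, v i * (Γ.laplacianTensor p).apply f i =
      2⁻¹ * (∑ i, ∑ j with Γ.graph.Adj i j,
        Γ.wt i j * ((f i - Γ.sgn i j * f j) ^ (p - 1) * (v i - Γ.sgn i j * v j))) +
      ∑ i, Γ.potential i * (f i ^ (p - 1) * v i) := by
  have hq : Odd (p - 1) := Nat.Even.sub_odd (NeZero.one_le) hp odd_one
  rw [sum_mul_diff Γ hq, ← mul_assoc, inv_mul_cancel₀ two_ne_zero, one_mul,
    ← Finset.sum_add_distrib]
  refine Finset.sum_congr rfl fun i _ => ?_
  rw [laplacianTensor_apply Γ hp, mul_add, Finset.mul_sum]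
  ring

theorem energy_eq_sum_mul_apply (Γ : SignedGraph V) {p : ℕ} [NeZero p] (hp : Even p)
    (f : V → ℝ) : Γ.energy p f = ∑ i, f i * (Γ.laplacianTensor p).apply f i := by
  have h : ∀ x : ℝ, x ^ (p - 1) * x = x ^ p := fun x => pow_sub_one_mul (NeZero.ne p) x
  rw [sum_mul_apply Γ hp, energy]
  simp only [h]

theorem mass_pos (Γ : SignedGraph V) {p : ℕ} (hp : Even p) {f : V → ℝ} (hf : f ≠ 0) :
    0 < Γ.mass p f := by
  obtain ⟨i, hi⟩ := Function.ne_iff.1 hf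
  exact Finset.sum_pos' (fun i _ => mul_nonneg (Γ.measure_pos i).le (hp.pow_nonneg _))
    ⟨i, Finset.mem_univ _, mul_pos (Γ.measure_pos i) (hp.pow_pos hi)⟩

theorem energy_eq_of_isEigenpair (Γ : SignedGraph V) {p : ℕ} [NeZero p] (hp : Even p) {c : ℝ}
    {f : V → ℝ} (h : (Γ.normTensor p).IsEigenpair c f) : Γ.energy p f = c * Γ.mass p f := by
  rw [normTensor_isEigenpair_iff] at h
  rw [energy_eq_sum_mul_apply Γ hp, mass, Finset.mul_sum]
  refine Finset.sum_congr rfl fun i _ => ?_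
  rw [h.2, ← pow_sub_one_mul (NeZero.ne p) (f i)]
  ring

theorem energy_smul (Γ : SignedGraph V) (p : ℕ) (c : ℝ) (f : V → ℝ) :
    Γ.energy p (c • f) = c ^ p * Γ.energy p f := by
  simp only [energy, Pi.smul_apply, smul_eq_mul, mul_add, Finset.mul_sum]
  congr 1
  · refine Finset.sum_congr rfl fun i _ => Finset.sum_congr rfl fun j _ => ?_
    have : c * f i - Γ.sgn i j * (c * f j) = c * (f i - Γ.sgn i j * f j) := by ring
    rw [this, mul_pow]; ring
  · exact Finset.sum_congr rfl fun i _ => by rw [mul_pow]; ring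

theorem mass_smul (Γ : SignedGraph V) (p : ℕ) (c : ℝ) (f : V → ℝ) :
    Γ.mass p (c • f) = c ^ p * Γ.mass p f := by
  simp only [mass, Pi.smul_apply, smul_eq_mul, Finset.mul_sum]
  exact Finset.sum_congr rfl fun i _ => by rw [mul_pow]; ring

theorem continuous_energy (Γ : SignedGraph V) (p : ℕ) : Continuous (Γ.energy p) := by
  unfold energy; fun_prop

theorem continuous_mass (Γ : SignedGraph V) (p : ℕ) : Continuous (Γ.mass p) := by
  unfold mass; fun_prop

/-- The quotient `energy / mass` attains its maximum on a compact sphere; both functions are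
homogeneous of degree `p`, and `c ^ p ≥ 0`, so the inequality extends to all `g`. -/
theorem exists_energy_le_mul_mass (Γ : SignedGraph V) [Nonempty V] {p : ℕ} (hp : Even p) :
    ∃ (c : ℝ) (f : V → ℝ), f ≠ 0 ∧ Γ.energy p f = c * Γ.mass p f ∧
      ∀ g, Γ.energy p g ≤ c * Γ.mass p g := by
  have hne : ∀ g ∈ Metric.sphere (0 : V → ℝ) 1, g ≠ 0 := fun g hg =>
    ne_zero_of_mem_unit_sphere ⟨g, hg⟩
  obtain ⟨f, hf, hmax⟩ := (isCompact_sphere (0 : V → ℝ) 1).exists_isMaxOn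
    (NormedSpace.sphere_nonempty.2 zero_le_one) (f := fun g => Γ.energy p g / Γ.mass p g)
    ((Γ.continuous_energy p).continuousOn.div (Γ.continuous_mass p).continuousOn
      fun g hg => (Γ.mass_pos hp (hne g hg)).ne')
  refine ⟨Γ.energy p f / Γ.mass p f, f, hne f hf, ?_, fun g => ?_⟩
  · rw [div_mul_cancel₀ _ (Γ.mass_pos hp (hne f hf)).ne']
  · have key : ∀ h ∈ Metric.sphere (0 : V → ℝ) 1,
        Γ.energy p h ≤ Γ.energy p f / Γ.mass p f * Γ.mass p h := fun h hh => by
      rw [← div_le_iff₀ (Γ.mass_pos hp (hne h hh))]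
      exact hmax hh
    have hk : ∃ (c : ℝ), ∃ h ∈ Metric.sphere (0 : V → ℝ) 1, g = c • h := by
      by_cases hg : g = 0
      · exact ⟨0, f, hf, by rw [hg, zero_smul]⟩
      · refine ⟨‖g‖, ‖g‖⁻¹ • g, ?_, ?_⟩
        · rw [mem_sphere_zero_iff_norm, norm_smul, norm_inv, norm_norm,
            inv_mul_cancel₀ (norm_ne_zero_iff.2 hg)]
        · rw [smul_smul, mul_inv_cancel₀ (norm_ne_zero_iff.2 hg), one_smul]
    obtain ⟨c, h, hh, rfl⟩ := hk
    rw [energy_smul, mass_smul]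
    calc c ^ p * Γ.energy p h ≤ c ^ p * (Γ.energy p f / Γ.mass p f * Γ.mass p h) :=
          mul_le_mul_of_nonneg_left (key h hh) (hp.pow_nonneg _)
      _ = _ := by ring

theorem hasDerivAt_energy (Γ : SignedGraph V) {p : ℕ} [NeZero p] (hp : Even p) (f v : V → ℝ) :
    HasDerivAt (fun t : ℝ => Γ.energy p (f + t • v))
      (p * ∑ i, v i * (Γ.laplacianTensor p).apply f i) 0 := by
  have h1 : ∀ a b : ℝ, HasDerivAt (fun t : ℝ => (a + t * b) ^ p) (p * a ^ (p - 1) * b) 0 := by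
    intro a b
    have := (((hasDerivAt_id (0 : ℝ)).mul_const b).const_add a).fun_pow p
    simpa using this
  have h2 : HasDerivAt (fun t : ℝ => Γ.energy p (f + t • v))
      (2⁻¹ * (∑ i, ∑ j with Γ.graph.Adj i j, Γ.wt i j *
        (p * (f i - Γ.sgn i j * f j) ^ (p - 1) * (v i - Γ.sgn i j * v j))) +
      ∑ i, Γ.potential i * (p * f i ^ (p - 1) * v i)) 0 := by
    unfold energy
    refine HasDerivAt.fun_add (HasDerivAt.const_mul _ (HasDerivAt.fun_sum fun i _ =>
      HasDerivAt.fun_sum fun j _ => HasDerivAt.const_mul _ ?_))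
      (HasDerivAt.fun_sum fun i _ => HasDerivAt.const_mul _ ?_)
    · refine (h1 (f i - Γ.sgn i j * f j) (v i - Γ.sgn i j * v j)).congr_of_eventuallyEq
        (Filter.Eventually.of_forall fun t => ?_)
      simp only [Pi.add_apply, Pi.smul_apply, smul_eq_mul]
      ring
    · exact h1 (f i) (v i)
  convert h2 using 1
  rw [sum_mul_apply Γ hp, mul_add]
  simp only [Finset.mul_sum]
  congr 1
  · exact Finset.sum_congr rfl fun i _ => Finset.sum_congr rfl fun j _ => by ring
  · exact Finset.sum_congr rfl fun i _ => by ring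

theorem hasDerivAt_mass (Γ : SignedGraph V) (p : ℕ) (f v : V → ℝ) :
    HasDerivAt (fun t : ℝ => Γ.mass p (f + t • v))
      (p * ∑ i, v i * (Γ.measure i * f i ^ (p - 1))) 0 := by
  have h2 : HasDerivAt (fun t : ℝ => Γ.mass p (f + t • v))
      (∑ i, Γ.measure i * (p * f i ^ (p - 1) * v i)) 0 := by
    unfold mass
    refine HasDerivAt.fun_sum fun i _ => HasDerivAt.const_mul _ ?_
    have := (((hasDerivAt_id (0 : ℝ)).mul_const (v i)).const_add (f i)).fun_pow p
    simpa using this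
  convert h2 using 1
  rw [Finset.mul_sum]
  exact Finset.sum_congr rfl fun i _ => by ring

/-- The function `energy - c * mass` has its maximum at `f`; its derivative in the `i`-th coordinate
direction is `p` times the defect of the eigenvalue equation at `i`. -/
theorem isEigenpair_of_energy_le (Γ : SignedGraph V) {p : ℕ} [NeZero p] (hp : Even p) {c : ℝ}
    {f : V → ℝ} (hf : f ≠ 0) (heq : Γ.energy p f = c * Γ.mass p f)
    (hle : ∀ g, Γ.energy p g ≤ c * Γ.mass p g) : (Γ.normTensor p).IsEigenpair c f := by
  rw [normTensor_isEigenpair_iff]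
  refine ⟨hf, fun i => ?_⟩
  have hd := (Γ.hasDerivAt_energy hp f (Pi.single i 1)).sub
    ((Γ.hasDerivAt_mass p f (Pi.single i 1)).const_mul c)
  have hmax : IsLocalMax ((fun t : ℝ => Γ.energy p (f + t • Pi.single i 1)) -
      fun t : ℝ => c * Γ.mass p (f + t • Pi.single i 1)) 0 := by
    refine Filter.Eventually.of_forall fun t => ?_
    simp only [Pi.sub_apply, zero_smul, add_zero]
    linarith [hle (f + t • Pi.single i 1)]
  have h0 := hmax.hasDerivAt_eq_zero hd
  simp only [Pi.single_apply, ite_mul, one_mul, zero_mul, Finset.sum_ite_eq', Finset.mem_univ,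
    if_true] at h0
  have hp0 : (p : ℝ) ≠ 0 := Nat.cast_ne_zero.2 (NeZero.ne p)
  have : (p : ℝ) * ((Γ.laplacianTensor p).apply f i - c * Γ.measure i * f i ^ (p - 1)) = 0 := by
    linarith
  exact sub_eq_zero.1 ((mul_eq_zero.1 this).resolve_left hp0)

/-- Pairing the equation of an eigenpair with its eigenvector shows that the eigenvalue is a value
of `energy / mass`. The inequality is kept in the conclusion as the source of lower bounds by test
functions. -/
theorem exists_isGreatest_eigenvalues (Γ : SignedGraph V) [Nonempty V] {p : ℕ} [NeZero p]
    (hp : Even p) : ∃ c, IsGreatest (Γ.normTensor p).eigenvalues c ∧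
      ∀ g, Γ.energy p g ≤ c * Γ.mass p g := by
  obtain ⟨c, f, hf, heq, hle⟩ := Γ.exists_energy_le_mul_mass hp
  refine ⟨c, ⟨⟨f, Γ.isEigenpair_of_energy_le hp hf heq hle⟩, ?_⟩, hle⟩
  rintro d ⟨g, hg⟩
  have h := hle g
  rw [Γ.energy_eq_of_isEigenpair hp hg] at h
  exact le_of_mul_le_mul_right h (Γ.mass_pos hp hg.1)

end SignedGraph

/-! ### The lower bound by root test functions -/

/-- The odd extension of the `m`-th root. -/
noncomputable def oddRoot (m : ℕ) (x : ℝ) : ℝ := x * |x| ^ ((m : ℝ)⁻¹ - 1)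

theorem abs_oddRoot_pow {m : ℕ} (hm : m ≠ 0) (x : ℝ) : |oddRoot m x| ^ m = |x| := by
  by_cases hx : x = 0
  · simp [oddRoot, hx, hm]
  · have h : |oddRoot m x| = |x| ^ ((m : ℝ)⁻¹) := by
      rw [oddRoot, abs_mul, abs_of_nonneg (Real.rpow_nonneg (abs_nonneg x) _)]
      conv_lhs => enter [1]; rw [← Real.rpow_one |x|]
      rw [← Real.rpow_add (abs_pos.2 hx)]
      congr 1; ring
    rw [h, Real.rpow_inv_natCast_pow (abs_nonneg x) hm]

/-- With `a`, `b` the roots, this is `4sab ≤ (a + sb)²` raised to the power `m`, as `s² = 1`. If `s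
x y ≤ 0` the left side is nonpositive and the right side an even power. -/
theorem two_pow_mul_le_oddRoot_add_pow {m : ℕ} (hm : m ≠ 0) {s : ℝ} (hs : s = 1 ∨ s = -1)
    (x y : ℝ) :
    2 ^ (2 * m) * (s * (x * y)) ≤ (oddRoot m x + s * oddRoot m y) ^ (2 * m) := by
  rcases le_or_gt (s * (x * y)) 0 with h | h
  · exact (mul_nonpos_of_nonneg_of_nonpos (by positivity) h).trans
      ((even_two_mul m).pow_nonneg _)
  · have h0 : 0 ≤ s * (oddRoot m x * oddRoot m y) := by
      have : s * (oddRoot m x * oddRoot m y) =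
          s * (x * y) * (|x| ^ ((m : ℝ)⁻¹ - 1) * |y| ^ ((m : ℝ)⁻¹ - 1)) := by
        unfold oddRoot; ring
      rw [this]
      exact mul_nonneg h.le (mul_nonneg (Real.rpow_nonneg (abs_nonneg _) _)
        (Real.rpow_nonneg (abs_nonneg _) _))
    have habs : |s| = 1 := by rcases hs with rfl | rfl <;> simp
    have hss : s ^ 2 = 1 := by rcases hs with rfl | rfl <;> simp
    have h1 : (s * (oddRoot m x * oddRoot m y)) ^ m = s * (x * y) := by
      rw [← abs_of_nonneg h0, ← abs_of_pos h]
      simp only [abs_mul, habs, one_mul, mul_pow, abs_oddRoot_pow hm]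
    have h2 : 4 * (s * (oddRoot m x * oddRoot m y)) ≤ (oddRoot m x + s * oddRoot m y) ^ 2 := by
      nlinarith [sq_nonneg (oddRoot m x - s * oddRoot m y)]
    calc 2 ^ (2 * m) * (s * (x * y)) = (4 * (s * (oddRoot m x * oddRoot m y))) ^ m := by
          rw [mul_pow, h1, pow_mul]; norm_num
      _ ≤ ((oddRoot m x + s * oddRoot m y) ^ 2) ^ m := pow_le_pow_left₀ (by positivity) h2 m
      _ = _ := (pow_mul _ _ _).symm

theorem oddRoot_pow_two_mul {m : ℕ} (hm : m ≠ 0) (x : ℝ) : oddRoot m x ^ (2 * m) = x ^ 2 := by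
  rw [mul_comm, pow_mul, ← sq_abs, abs_pow, abs_oddRoot_pow hm, sq_abs]

namespace SignedGraph

variable {V : Type*} [Fintype V]

/-- The quadratic form of the adjacency matrix of the negated subgraph, on functions on the
whole vertex set. -/
noncomputable def subgraphForm (Γ : SignedGraph V) (H : Γ.graph.Subgraph) (g : V → ℝ) : ℝ :=
  ∑ i, ∑ j, if H.Adj i j then -Γ.sgn i j * Γ.wt i j * (g i * g j) else 0

omit [Fintype V] in
theorem sgn_neg (Γ : SignedGraph V) (i j : V) : Γ.neg.sgn i j = -Γ.sgn i j := by
  simp [sgn, neg]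

omit [Fintype V] in
theorem adjMatrix_neg_restrict (Γ : SignedGraph V) (H : Γ.graph.Subgraph) (i j : H.verts) :
    (Γ.restrict H).neg.adjMatrix i j =
      if H.Adj i j then -Γ.sgn i j * Γ.wt i j else 0 := by
  rw [adjMatrix, Matrix.of_apply, sgn_neg]
  rfl

theorem adjForm_neg_restrict (Γ : SignedGraph V) (H : Γ.graph.Subgraph) [Fintype H.verts]
    (g : V → ℝ) (hg : ∀ i ∉ H.verts, g i = 0) :
    (Γ.restrict H).neg.adjForm (fun i => g i) = Γ.subgraphForm H g := by
  unfold adjForm subgraphForm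
  refine Fintype.sum_of_injective Subtype.val Subtype.val_injective _ _ (fun i hi => ?_)
    fun i => Fintype.sum_of_injective Subtype.val Subtype.val_injective _ _ (fun j hj => ?_)
      fun j => ?_
  · simp [hg i (by simpa using hi)]
  · simp [hg j (by simpa using hj)]
  · rw [adjMatrix_neg_restrict]
    split_ifs <;> simp

theorem sum_measure_restrict (Γ : SignedGraph V) (H : Γ.graph.Subgraph) [Fintype H.verts]
    (g : V → ℝ) (hg : ∀ i ∉ H.verts, g i = 0) :
    ∑ i, (Γ.restrict H).neg.measure i * g i ^ 2 = ∑ i, Γ.measure i * g i ^ 2 := by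
  refine Fintype.sum_of_injective Subtype.val Subtype.val_injective _ _ (fun i hi => ?_)
    fun i => rfl
  simp [hg i (by simpa using hi)]

theorem exists_subgraphForm_eq (Γ : SignedGraph V) (H : Γ.graph.Subgraph) [Fintype H.verts]
    (hH : H.verts.Nonempty) :
    ∃ g : V → ℝ, g ≠ 0 ∧
      Γ.subgraphForm H g = (Γ.restrict H).topNegEigenvalue * ∑ i, Γ.measure i * g i ^ 2 := by
  have := hH.to_subtype
  obtain ⟨g', hg', heig⟩ := (Γ.restrict H).neg.exists_topEigenvector
  set g : V → ℝ := Function.extend Subtype.val g' 0 with hgdef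
  have hval : (fun i : H.verts => g i) = g' :=
    funext fun i => Subtype.val_injective.extend_apply g' 0 i
  have hz : ∀ i ∉ H.verts, g i = 0 := fun i hi => by
    rw [hgdef, Function.extend_apply' _ _ _ (by simpa using hi)]; rfl
  refine ⟨g, fun h => hg' ?_, ?_⟩
  · rw [← hval, h]; rfl
  · rw [← adjForm_neg_restrict Γ H g hz, ← sum_measure_restrict Γ H g hz]
    exact adjForm_eq_of_mulVec_eq _ (by rw [hval]; exact heig)

theorem subgraphForm_le (Γ : SignedGraph V) [Nonempty V] (H : Γ.graph.Subgraph) [Fintype H.verts]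
    (hH : H.verts = Set.univ) (g : V → ℝ) :
    Γ.subgraphForm H g ≤ (Γ.restrict H).topNegEigenvalue * ∑ i, Γ.measure i * g i ^ 2 := by
  have hz : ∀ i ∉ H.verts, g i = 0 := fun i hi => absurd (hH ▸ Set.mem_univ i) hi
  have : Nonempty H.verts := (hH ▸ Set.univ_nonempty : H.verts.Nonempty).to_subtype
  rw [← adjForm_neg_restrict Γ H g hz, ← sum_measure_restrict Γ H g hz]
  exact adjForm_le _ _

/-- The spanning subgraph with the same edges. -/
def spanningSubgraph {G : SimpleGraph V} (H : G.Subgraph) : G.Subgraph where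
  verts := Set.univ
  Adj := H.Adj
  adj_sub := H.adj_sub
  edge_vert _ := Set.mem_univ _
  symm := H.symm

/-- A top eigenvector extended by zero keeps its form and its norm, so it is a test vector for the
spanning subgraph. -/
theorem topNegEigenvalue_le_spanningSubgraph (Γ : SignedGraph V) [Nonempty V]
    (H : Γ.graph.Subgraph) [Fintype H.verts] [Fintype (spanningSubgraph H).verts]
    (hH : H.verts.Nonempty) :
    (Γ.restrict H).topNegEigenvalue ≤ (Γ.restrict (spanningSubgraph H)).topNegEigenvalue := by
  obtain ⟨g, hg, heq⟩ := Γ.exists_subgraphForm_eq H hH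
  have h := Γ.subgraphForm_le (spanningSubgraph H) rfl g
  have h' : Γ.subgraphForm (spanningSubgraph H) g = Γ.subgraphForm H g := rfl
  rw [h', heq] at h
  exact le_of_mul_le_mul_right h (Γ.sum_measure_mul_sq_pos hg)

theorem abs_potential_le (Γ : SignedGraph V) [Nonempty V] (i : V) :
    |Γ.potential i| ≤ Γ.potentialBound * Γ.measure i := by
  have h : |Γ.potential i / Γ.measure i| ≤ Γ.potentialBound :=
    Finset.le_sup' (fun i => |Γ.potential i / Γ.measure i|) (Finset.mem_univ i)
  rwa [abs_div, abs_of_pos (Γ.measure_pos i), div_le_iff₀ (Γ.measure_pos i)] at h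

theorem abs_sum_potential_le (Γ : SignedGraph V) [Nonempty V] {p : ℕ} (hp : Even p) (f : V → ℝ) :
    |∑ i, Γ.potential i * f i ^ p| ≤ Γ.potentialBound * Γ.mass p f := by
  rw [mass, Finset.mul_sum]
  refine (Finset.abs_sum_le_sum_abs _ _).trans (Finset.sum_le_sum fun i _ => ?_)
  rw [abs_mul, abs_of_nonneg (hp.pow_nonneg (f i)), ← mul_assoc]
  exact mul_le_mul_of_nonneg_right (Γ.abs_potential_le i) (hp.pow_nonneg _)

theorem le_energy_oddRoot (Γ : SignedGraph V) [Nonempty V] (H : Γ.graph.Subgraph) {m : ℕ}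
    (hm : m ≠ 0) (g : V → ℝ) :
    2⁻¹ * (2 ^ (2 * m) * Γ.subgraphForm H g) - Γ.potentialBound * ∑ i, Γ.measure i * g i ^ 2 ≤
      Γ.energy (2 * m) (fun i => oddRoot m (g i)) := by
  have h1 := (abs_le.1 (Γ.abs_sum_potential_le (even_two_mul m) fun i => oddRoot m (g i))).1
  have h2 : Γ.mass (2 * m) (fun i => oddRoot m (g i)) = ∑ i, Γ.measure i * g i ^ 2 := by
    simp only [mass, oddRoot_pow_two_mul hm]
  have h3 : 2 ^ (2 * m) * Γ.subgraphForm H g ≤ ∑ i, ∑ j with Γ.graph.Adj i j,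
      Γ.wt i j * (oddRoot m (g i) - Γ.sgn i j * oddRoot m (g j)) ^ (2 * m) := by
    simp only [subgraphForm, Finset.mul_sum, Finset.sum_filter]
    refine Finset.sum_le_sum fun i _ => Finset.sum_le_sum fun j _ => ?_
    by_cases hH : H.Adj i j
    · have hG := H.adj_sub hH
      have hs : -Γ.sgn i j = 1 ∨ -Γ.sgn i j = -1 := by
        rcases Γ.sgn_eq i j with h | h <;> simp [h]
      rw [if_pos hH, if_pos hG]
      have := mul_le_mul_of_nonneg_left (two_pow_mul_le_oddRoot_add_pow hm hs (g i) (g j))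
        (Γ.wt_pos hG).le
      calc _ = Γ.wt i j * (2 ^ (2 * m) * (-Γ.sgn i j * (g i * g j))) := by ring
        _ ≤ _ := this
        _ = _ := by rw [neg_mul, ← sub_eq_add_neg]
    · rw [if_neg hH, mul_zero]
      split_ifs with hG
      -- Edges outside `H` only add nonnegative energy.
      · exact mul_nonneg (Γ.wt_pos hG).le ((even_two_mul m).pow_nonneg _)
      · exact le_rfl
  rw [h2] at h1
  unfold energy
  linarith

theorem lower_bound_of_energy_le (Γ : SignedGraph V) [Nonempty V] (H : Γ.graph.Subgraph)
    [Fintype H.verts] (hH : H.verts.Nonempty) {p : ℕ} [NeZero p] (hp : Even p) {c : ℝ}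
    (hc : ∀ g, Γ.energy p g ≤ c * Γ.mass p g) :
    2 ^ (p - 1) * (Γ.restrict H).topNegEigenvalue - Γ.potentialBound ≤ c := by
  obtain ⟨m, rfl⟩ := even_iff_two_dvd.1 hp
  have hm : m ≠ 0 := fun h => NeZero.ne (2 * m) (by rw [h, mul_zero])
  obtain ⟨g, hg, heq⟩ := Γ.exists_subgraphForm_eq H hH
  have h1 := (Γ.le_energy_oddRoot H hm g).trans (hc _)
  have h2 : Γ.mass (2 * m) (fun i => oddRoot m (g i)) = ∑ i, Γ.measure i * g i ^ 2 := by
    simp only [mass, oddRoot_pow_two_mul hm]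
  rw [h2, heq] at h1
  -- The factor `1/2` in the energy turns `2 ^ p` into `2 ^ (p - 1)`.
  have hpow : (2 : ℝ) ^ (2 * m) = 2 * 2 ^ (2 * m - 1) :=
    (mul_pow_sub_one (NeZero.ne (2 * m)) 2).symm
  rw [hpow] at h1
  refine le_of_mul_le_mul_right ?_ (Γ.sum_measure_mul_sq_pos hg)
  linarith

theorem exists_isGreatest_topNegEigenvalue (Γ : SignedGraph V) [Nonempty V]
    [∀ H : Γ.graph.Subgraph, Fintype H.verts] :
    ∃ H : Γ.graph.Subgraph, H.verts = Set.univ ∧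
      ∀ H' : Γ.graph.Subgraph, H'.verts.Nonempty →
        (Γ.restrict H').topNegEigenvalue ≤ (Γ.restrict H).topNegEigenvalue := by
  have : Finite Γ.graph.Subgraph := by
    refine Finite.of_injective (fun H : Γ.graph.Subgraph => (H.verts, H.Adj)) fun H H' h => ?_
    exact SimpleGraph.Subgraph.ext (congrArg Prod.fst h) (congrArg Prod.snd h)
  obtain ⟨H, hH, hmax⟩ := Set.exists_max_image {H : Γ.graph.Subgraph | H.verts.Nonempty}
    (fun H => (Γ.restrict H).topNegEigenvalue) (Set.toFinite _)
    ⟨⊤, by simp [Set.univ_nonempty]⟩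
  exact ⟨spanningSubgraph H, rfl, fun H' hH' => (hmax H' hH').trans
    (Γ.topNegEigenvalue_le_spanningSubgraph H hH)⟩

end SignedGraph

/-! ### Power means decreasing to the geometric mean -/

section PowerMean

/-- The square of the power mean of exponent `2 / p`. -/
noncomputable def sqPowerMean (p : ℕ) (x y : ℝ) : ℝ :=
  ((x ^ (2 / (p : ℝ)) + y ^ (2 / (p : ℝ))) / 2) ^ p

/-- Convexity of `t ↦ t ^ (q / p)` at the points `x ^ (2 / q)` and `y ^ (2 / q)`, raised to the
power `p`. -/
theorem sqPowerMean_antitone {p q : ℕ} (hp : 0 < p) (hpq : p ≤ q) {x y : ℝ} (hx : 0 ≤ x)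
    (hy : 0 ≤ y) : sqPowerMean q x y ≤ sqPowerMean p x y := by
  have hp' : (0 : ℝ) < p := Nat.cast_pos.2 hp
  have hq' : (0 : ℝ) < q := Nat.cast_pos.2 (hp.trans_le hpq)
  have hr : 1 ≤ (q : ℝ) / p := (one_le_div hp').2 (Nat.cast_le.2 hpq)
  set X := x ^ (2 / (q : ℝ)) with hX
  set Y := y ^ (2 / (q : ℝ)) with hY
  have hX0 : 0 ≤ X := Real.rpow_nonneg hx _
  have hY0 : 0 ≤ Y := Real.rpow_nonneg hy _
  have hexp : 2 / (q : ℝ) * (q / p) = 2 / p := by field_simp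
  have hXp : X ^ ((q : ℝ) / p) = x ^ (2 / (p : ℝ)) := by rw [hX, ← Real.rpow_mul hx, hexp]
  have hYp : Y ^ ((q : ℝ) / p) = y ^ (2 / (p : ℝ)) := by rw [hY, ← Real.rpow_mul hy, hexp]
  have hconv := (convexOn_rpow hr).2 hX0 hY0 (by norm_num : (0 : ℝ) ≤ 1 / 2)
    (by norm_num : (0 : ℝ) ≤ 1 / 2) (by norm_num)
  simp only [smul_eq_mul, hXp, hYp] at hconv
  have hmean : 0 ≤ 1 / 2 * X + 1 / 2 * Y := by positivity
  have h := pow_le_pow_left₀ (Real.rpow_nonneg hmean _) hconv p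
  rw [← Real.rpow_mul_natCast hmean, div_mul_cancel₀ _ hp'.ne', Real.rpow_natCast] at h
  unfold sqPowerMean
  calc ((X + Y) / 2) ^ q = (1 / 2 * X + 1 / 2 * Y) ^ q := by ring
    _ ≤ _ := h
    _ = _ := by ring

theorem tendsto_sqPowerMean {x y : ℝ} (hx : 0 ≤ x) (hy : 0 ≤ y) :
    Tendsto (fun p => sqPowerMean p x y) atTop (𝓝 (x * y)) := by
  -- If one argument vanishes, the expression is `z² / 2 ^ p`.
  have hzero : ∀ z : ℝ, 0 ≤ z →
      Tendsto (fun p : ℕ => (z ^ (2 / (p : ℝ)) / 2) ^ p) atTop (𝓝 0) := by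
    intro z hz
    have h : Tendsto (fun p : ℕ => z ^ 2 * (1 / 2 : ℝ) ^ p) atTop (𝓝 (z ^ 2 * 0)) :=
      (tendsto_pow_atTop_nhds_zero_of_lt_one (by norm_num) (by norm_num)).const_mul _
    rw [mul_zero] at h
    refine h.congr' ?_
    filter_upwards [eventually_gt_atTop 0] with p hp
    have hp' : (p : ℝ) ≠ 0 := Nat.cast_ne_zero.2 hp.ne'
    rw [div_pow (z ^ _), ← Real.rpow_mul_natCast hz, div_mul_cancel₀ _ hp', one_div, inv_pow,
      Real.rpow_ofNat, div_eq_mul_inv]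
  have hz0 : ∀ p : ℕ, 0 < p → (0 : ℝ) ^ (2 / (p : ℝ)) = 0 := fun p hp =>
    Real.zero_rpow (div_ne_zero two_ne_zero (Nat.cast_ne_zero.2 hp.ne'))
  rcases hx.eq_or_lt with rfl | hx
  · rw [zero_mul]
    refine (hzero y hy).congr' ?_
    filter_upwards [eventually_gt_atTop 0] with p hp
    rw [sqPowerMean, hz0 p hp, zero_add]
  rcases hy.eq_or_lt with rfl | hy
  · rw [mul_zero]
    refine (hzero x hx.le).congr' ?_
    filter_upwards [eventually_gt_atTop 0] with p hp
    rw [sqPowerMean, hz0 p hp, add_zero]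
  -- For positive arguments, the derivative at `0` along `t = 2 / p` shows that the mean is `1 +
  -- (log x + log y + o(1)) / p`; its `p`-th power tends to the exponential of `log x + log y`.
  have hd : HasDerivAt (fun t : ℝ => (x ^ t + y ^ t) / 2) ((Real.log x + Real.log y) / 2) 0 := by
    have := ((Real.hasStrictDerivAt_const_rpow hx 0).hasDerivAt.fun_add
      (Real.hasStrictDerivAt_const_rpow hy 0).hasDerivAt).div_const 2
    simpa using this
  have hto : Tendsto (fun p : ℕ => 2 / (p : ℝ)) atTop (𝓝[>] 0) := by
    refine tendsto_nhdsWithin_iff.2 ⟨tendsto_const_div_atTop_nhds_zero_nat 2, ?_⟩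
    filter_upwards [eventually_gt_atTop 0] with p hp
    have hp' : (0 : ℝ) < p := Nat.cast_pos.2 hp
    exact div_pos two_pos hp'
  have hs := (hd.tendsto_slope_zero_right.comp hto).const_mul 2
  have hlim : Tendsto (fun p : ℕ => (p : ℝ) *
      ((x ^ (2 / (p : ℝ)) + y ^ (2 / (p : ℝ))) / 2 - 1)) atTop
      (𝓝 (Real.log x + Real.log y)) := by
    convert hs using 1
    · ext p
      simp only [Function.comp, zero_add, Real.rpow_zero, smul_eq_mul, inv_div]
      ring
    · congr 1; ring
  have hfin := Real.tendsto_one_add_pow_exp_of_tendsto hlim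
  rw [Real.exp_add, Real.exp_log hx, Real.exp_log hy] at hfin
  refine hfin.congr fun p => ?_
  rw [sqPowerMean]; congr 1; ring

theorem continuous_sqPowerMean (p : ℕ) : Continuous fun z : ℝ × ℝ => sqPowerMean p z.1 z.2 := by
  have h := Real.continuous_rpow_const (q := 2 / (p : ℝ)) (by positivity)
  unfold sqPowerMean
  exact (((h.comp continuous_fst).add (h.comp continuous_snd)).div_const 2).pow p

end PowerMean

/-! ### Perron-Frobenius uniqueness and the limit of the top eigenvectors -/

namespace SignedGraph

variable {V : Type*} [Fintype V]

/-- At a zero of `g` the eigenvalue equation is a vanishing sum of nonnegative terms, so `g`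
vanishes at all neighbours, and connectedness spreads this. -/
theorem eq_zero_of_nonneg_of_apply_eq_zero (Γ : SignedGraph V) (hG : Γ.graph.Connected)
    (hs : ∀ i j, Γ.graph.Adj i j → Γ.sgn i j = 1) {c : ℝ} {g : V → ℝ}
    (heig : Γ.normAdjMatrix.mulVec g = c • g) (hg : ∀ i, 0 ≤ g i) {i : V} (hi : g i = 0) :
    g = 0 := by
  rw [normAdjMatrix_mulVec_eq_iff] at heig
  have hstep : ∀ a b, Γ.graph.Adj a b → g a = 0 → g b = 0 := by
    intro a b hab ha
    have h := heig a
    rw [ha, mul_zero, mul_zero] at h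
    have hnn : ∀ j ∈ Finset.univ, 0 ≤ Γ.adjMatrix a j * g j := by
      intro j _
      refine mul_nonneg ?_ (hg j)
      rw [adjMatrix, Matrix.of_apply]
      split_ifs with hj
      · rw [hs a j hj, one_mul]; exact (Γ.wt_pos hj).le
      · exact le_rfl
    have h' := (Finset.sum_eq_zero_iff_of_nonneg hnn).1 h b (Finset.mem_univ b)
    rw [adjMatrix, Matrix.of_apply, if_pos hab, hs a b hab, one_mul] at h'
    exact (mul_eq_zero.1 h').resolve_left (Γ.wt_pos hab).ne'
  ext j
  obtain ⟨w⟩ := hG.preconnected i j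
  induction w with
  | nil => exact hi
  | cons hab _ ih => exact ih (hstep _ _ hab hi)

theorem eq_of_nonneg_of_mulVec_eq (Γ : SignedGraph V) (hG : Γ.graph.Connected)
    (hs : ∀ i j, Γ.graph.Adj i j → Γ.sgn i j = 1) {c : ℝ} {g h : V → ℝ}
    (heg : Γ.normAdjMatrix.mulVec g = c • g) (heh : Γ.normAdjMatrix.mulVec h = c • h)
    (hg : ∀ i, 0 ≤ g i) (hh : ∀ i, 0 ≤ h i) (hg1 : ∑ i, Γ.measure i * g i ^ 2 = 1)
    (hh1 : ∑ i, Γ.measure i * h i ^ 2 = 1) : h = g := by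
  have := hG.nonempty
  have hgpos : ∀ i, 0 < g i := fun i => (hg i).lt_of_ne' fun hi => by
    have := Γ.eq_zero_of_nonneg_of_apply_eq_zero hG hs heg hg hi
    simp [this] at hg1
  -- The minimum `t` is the largest number with `h - t • g ≥ 0`; this difference is an eigenfunction
  -- or zero and has a zero at `i`, so it vanishes.
  obtain ⟨i, -, hi⟩ := Finset.exists_min_image Finset.univ (fun i => h i / g i)
    Finset.univ_nonempty
  set t := h i / g i with ht
  have ht0 : 0 ≤ t := div_nonneg (hh i) (hg i)
  have hz : h - t • g = 0 := by
    refine Γ.eq_zero_of_nonneg_of_apply_eq_zero hG hs (c := c) ?_ (fun j => ?_) (i := i) ?_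
    · rw [Matrix.mulVec_sub, Matrix.mulVec_smul, heg, heh, smul_sub, smul_comm]
    · have := hi j (Finset.mem_univ j)
      rw [le_div_iff₀ (hgpos j)] at this
      simpa using this
    · simp [ht, div_mul_cancel₀ _ (hgpos i).ne']
  have hhg : h = t • g := sub_eq_zero.1 hz
  have hsq : t ^ 2 = 1 := by
    rw [hhg] at hh1
    simp only [Pi.smul_apply, smul_eq_mul, mul_pow, mul_left_comm _ (t ^ 2)] at hh1
    rwa [← Finset.mul_sum, hg1, mul_one] at hh1
  rw [hhg, (pow_eq_one_iff_of_nonneg ht0 two_ne_zero).1 hsq, one_smul]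

theorem exists_nonneg_topEigenvector (Γ : SignedGraph V) [Nonempty V]
    (hs : ∀ i j, Γ.graph.Adj i j → Γ.sgn i j = 1) :
    ∃ g : V → ℝ, (∀ i, 0 ≤ g i) ∧ ∑ i, Γ.measure i * g i ^ 2 = 1 ∧
      Γ.normAdjMatrix.mulVec g = Γ.topEigenvalue • g := by
  obtain ⟨g, hg, heig⟩ := Γ.exists_topEigenvector
  have hpos := Γ.sum_measure_mul_sq_pos hg
  set N := ∑ i, Γ.measure i * g i ^ 2 with hN
  -- The matrix entries are nonnegative, so absolute values do not lower the form and keep the norm.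
  have habs : Γ.normAdjMatrix.mulVec (fun i => |g i|) = Γ.topEigenvalue • fun i => |g i| := by
    refine Γ.mulVec_eq_of_le_adjForm ?_
    simp only [sq_abs]
    rw [← Γ.adjForm_eq_of_mulVec_eq heig]
    refine Finset.sum_le_sum fun i _ => Finset.sum_le_sum fun j _ => ?_
    refine mul_le_mul_of_nonneg_left ?_ ?_
    · rw [← abs_mul]; exact le_abs_self _
    · rw [adjMatrix, Matrix.of_apply]
      split_ifs with hj
      · rw [hs i j hj, one_mul]; exact (Γ.wt_pos hj).le
      · exact le_rfl
  refine ⟨(√N)⁻¹ • fun i => |g i|, fun i => ?_, ?_, ?_⟩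
  · exact mul_nonneg (inv_nonneg.2 (Real.sqrt_nonneg _)) (abs_nonneg _)
  · simp only [Pi.smul_apply, smul_eq_mul, mul_pow, sq_abs, inv_pow, Real.sq_sqrt hpos.le,
      mul_left_comm _ N⁻¹]
    rw [← Finset.mul_sum, ← hN, inv_mul_cancel₀ hpos.ne']
  · rw [Matrix.mulVec_smul, habs, smul_comm]

omit [Fintype V] in
theorem AllNegative.sgn_eq_neg_one {Γ : SignedGraph V} (h : Γ.AllNegative) {i j : V}
    (hij : Γ.graph.Adj i j) : Γ.sgn i j = -1 := by
  rw [sgn, h s(i, j) hij]; simp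

/-- The weighted sum of squared power means over the edges. -/
noncomputable def powerMeanForm (Γ : SignedGraph V) (p : ℕ) (h : V → ℝ) : ℝ :=
  ∑ i, ∑ j with Γ.graph.Adj i j, Γ.wt i j * sqPowerMean p (h i) (h j)

theorem powerMeanForm_antitone (Γ : SignedGraph V) {p q : ℕ} (hp : 0 < p) (hpq : p ≤ q)
    {h : V → ℝ} (hh : ∀ i, 0 ≤ h i) : Γ.powerMeanForm q h ≤ Γ.powerMeanForm p h :=
  Finset.sum_le_sum fun i _ => Finset.sum_le_sum fun j hj =>
    mul_le_mul_of_nonneg_left (sqPowerMean_antitone hp hpq (hh i) (hh j))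
      (Γ.wt_pos (Finset.mem_filter.1 hj).2).le

theorem continuous_powerMeanForm (Γ : SignedGraph V) (p : ℕ) : Continuous (Γ.powerMeanForm p) := by
  unfold powerMeanForm
  exact continuous_finsetSum _ fun i _ => continuous_finsetSum _ fun j _ =>
    continuous_const.mul ((continuous_sqPowerMean p).comp₂ (continuous_apply i)
      (continuous_apply j))

theorem tendsto_powerMeanForm {Γ : SignedGraph V} (hΓ : Γ.AllNegative) {h : V → ℝ}
    (hh : ∀ i, 0 ≤ h i) :
    Tendsto (fun p => Γ.powerMeanForm p h) atTop (𝓝 (Γ.neg.adjForm h)) := by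
  have heq : Γ.neg.adjForm h = ∑ i, ∑ j with Γ.graph.Adj i j, Γ.wt i j * (h i * h j) := by
    unfold adjForm
    simp only [Finset.sum_filter]
    refine Finset.sum_congr rfl fun i _ => Finset.sum_congr rfl fun j _ => ?_
    rw [adjMatrix, Matrix.of_apply, sgn_neg]
    change (if Γ.graph.Adj i j then -Γ.sgn i j * Γ.wt i j else 0) * _ = _
    split_ifs with hij
    · rw [hΓ.sgn_eq_neg_one hij]; ring
    · rw [zero_mul]
  rw [heq]
  exact tendsto_finsetSum _ fun i _ => tendsto_finsetSum _ fun j _ =>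
    (tendsto_sqPowerMean (hh i) (hh j)).const_mul _

/-- For `σ = -1` the edge terms are `(f i + f j) ^ p ≤ (|f i| + |f j|) ^ p`, and `|f i|` is the `2 /
p`-th power of `|f i| ^ (p / 2)`. -/
theorem energy_le_powerMeanForm {Γ : SignedGraph V} [Nonempty V] (hΓ : Γ.AllNegative) {p : ℕ}
    [NeZero p] (hp : Even p) (f : V → ℝ) :
    Γ.energy p f ≤ 2 ^ (p - 1) * Γ.powerMeanForm p (fun i => |f i| ^ ((p : ℝ) / 2)) +
      Γ.potentialBound * Γ.mass p f := by
  have h1 := (abs_le.1 (Γ.abs_sum_potential_le hp f)).2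
  have hp0 : (p : ℝ) ≠ 0 := Nat.cast_ne_zero.2 (NeZero.ne p)
  have hroot : ∀ i, (|f i| ^ ((p : ℝ) / 2)) ^ (2 / (p : ℝ)) = |f i| := fun i => by
    rw [← Real.rpow_mul (abs_nonneg _), div_mul_div_cancel₀ two_ne_zero, div_self hp0,
      Real.rpow_one]
  have h2 : ∑ i, ∑ j with Γ.graph.Adj i j, Γ.wt i j * (f i - Γ.sgn i j * f j) ^ p ≤
      2 ^ p * Γ.powerMeanForm p (fun i => |f i| ^ ((p : ℝ) / 2)) := by
    simp only [powerMeanForm, Finset.mul_sum]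
    refine Finset.sum_le_sum fun i _ => Finset.sum_le_sum fun j hj => ?_
    have hij := (Finset.mem_filter.1 hj).2
    rw [hΓ.sgn_eq_neg_one hij, mul_left_comm, sqPowerMean, hroot, hroot, ← mul_pow,
      mul_div_cancel₀ _ two_ne_zero]
    refine mul_le_mul_of_nonneg_left ?_ (Γ.wt_pos hij).le
    rw [neg_one_mul, sub_neg_eq_add, ← hp.pow_abs]
    exact pow_le_pow_left₀ (abs_nonneg _) (abs_add_le _ _) p
  have hpow : (2 : ℝ) ^ p = 2 * 2 ^ (p - 1) := (mul_pow_sub_one (NeZero.ne p) 2).symm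
  rw [hpow] at h2
  unfold energy
  linarith

theorem mass_eq_one_of_mem_unitSphere (Γ : SignedGraph V) {p : ℕ} (hp : Even p) {f : V → ℝ}
    (hf : f ∈ Γ.unitSphere p) : Γ.mass p f = 1 := by
  rw [← hf, mass]
  simp only [Real.rpow_natCast, hp.pow_abs]

/-- The nonnegative part of the unit sphere of `ℓ²(μ)`. -/
def nonnegSphere (Γ : SignedGraph V) : Set (V → ℝ) :=
  {h | (∀ i, 0 ≤ h i) ∧ ∑ i, Γ.measure i * h i ^ 2 = 1}

theorem isCompact_nonnegSphere (Γ : SignedGraph V) : IsCompact Γ.nonnegSphere := by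
  refine IsCompact.of_isClosed_subset
    (isCompact_Icc (a := (0 : V → ℝ)) (b := fun i => √((Γ.measure i)⁻¹))) ?_ ?_
  · have hset : Γ.nonnegSphere = (⋂ i, {h | 0 ≤ h i}) ∩
        {h | ∑ i, Γ.measure i * h i ^ 2 = 1} := by
      ext h; simp [nonnegSphere]
    rw [hset]
    refine IsClosed.inter ?_ ?_
    · exact isClosed_iInter fun i => isClosed_le continuous_const (continuous_apply i)
    · exact isClosed_eq (by fun_prop) continuous_const
  · rintro h ⟨h0, h1⟩
    refine ⟨h0, fun i => Real.le_sqrt_of_sq_le ?_⟩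
    rw [← one_div, le_div_iff₀ (Γ.measure_pos i), mul_comm, ← h1]
    exact Finset.single_le_sum (f := fun i => Γ.measure i * h i ^ 2)
      (fun j _ => mul_nonneg (Γ.measure_pos j).le (sq_nonneg _)) (Finset.mem_univ i)

theorem rpow_half_mem_nonnegSphere (Γ : SignedGraph V) {p : ℕ} {f : V → ℝ}
    (hf : f ∈ Γ.unitSphere p) : (fun i => |f i| ^ ((p : ℝ) / 2)) ∈ Γ.nonnegSphere := by
  refine ⟨fun i => Real.rpow_nonneg (abs_nonneg _) _, ?_⟩
  rw [← hf]
  refine Finset.sum_congr rfl fun i _ => ?_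
  rw [← Real.rpow_mul_natCast (abs_nonneg _)]
  norm_num

theorem exists_tendsto_rpow_half (Γ : SignedGraph V) [Nonempty V] (hG : Γ.graph.Connected)
    (hΓ : Γ.AllNegative) {η : ℕ → ℝ}
    (hη : ∀ (p : ℕ) [NeZero p], Even p →
      2 ^ (p - 1) * Γ.topNegEigenvalue - Γ.potentialBound ≤ η p) :
    ∃ g : V → ℝ, (g ≠ 0 ∧ Γ.neg.normAdjMatrix.mulVec g = Γ.topNegEigenvalue • g) ∧
      ∀ f : ℕ → V → ℝ,
        (∀ (p : ℕ) [NeZero p], Even p →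
          f p ∈ Γ.unitSphere p ∧ (Γ.normTensor p).IsEigenpair (η p) (f p)) →
        ∀ i, Tendsto (fun p : ℕ => |f p i| ^ ((p : ℝ) / 2))
          (atTop ⊓ 𝓟 {p : ℕ | Even p}) (𝓝 (g i)) := by
  have hs : ∀ i j, Γ.neg.graph.Adj i j → Γ.neg.sgn i j = 1 := fun i j hij => by
    rw [sgn_neg, hΓ.sgn_eq_neg_one hij, neg_neg]
  obtain ⟨g, hg0, hg1, heig⟩ := Γ.neg.exists_nonneg_topEigenvector hs
  refine ⟨g, ⟨?_, heig⟩, fun f hf => ?_⟩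
  · rintro rfl
    simp at hg1
  rw [← tendsto_pi_nhds (f := fun (p : ℕ) i => |f p i| ^ ((p : ℝ) / 2))]
  -- The value `p = 0` is even but excluded by `NeZero`; it is discarded along the filter.
  have hev : ∀ {P : ℕ → Prop}, (∀ᶠ p in atTop, 0 < p → Even p → P p) →
      ∀ᶠ p in atTop ⊓ 𝓟 {p : ℕ | Even p}, P p := by
    intro P hP
    rw [eventually_inf_principal]
    filter_upwards [hP, eventually_gt_atTop 0] with p h hp hp' using h hp hp'
  refine Γ.isCompact_nonnegSphere.tendsto_nhds_of_unique_mapClusterPt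
    (hev (Eventually.of_forall fun p hp0 hp => ?_)) fun h hh hcl => ?_
  · have : NeZero p := ⟨hp0.ne'⟩
    exact Γ.rpow_half_mem_nonnegSphere (hf p hp).1
  -- Both the form and its argument depend on `p`. Monotonicity replaces the form at `p ≥ q` by the
  -- fixed continuous form at `q`, so the bound passes to the cluster point; only then does `q` tend
  -- to infinity.
  have hbound : ∀ q : ℕ, 0 < q → Γ.topNegEigenvalue ≤ Γ.powerMeanForm q h := by
    intro q hq
    refine le_of_forall_pos_sub_le fun ε hε => ?_
    have hclosed : IsClosed {x : V → ℝ | Γ.topNegEigenvalue - ε ≤ Γ.powerMeanForm q x} :=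
      isClosed_le continuous_const (Γ.continuous_powerMeanForm q)
    refine hclosed.mem_of_mapClusterPt hcl (hev ?_)
    have hpow : Tendsto (fun p : ℕ => (2 : ℝ) ^ (p - 1)) atTop atTop :=
      (tendsto_pow_atTop_atTop_of_one_lt one_lt_two).comp (tendsto_sub_atTop_nat 1)
    -- The potential costs `potentialBound` twice: in the lower bound for `η p` and in the upper
    -- bound for the energy.
    filter_upwards [hpow.eventually_ge_atTop (2 * Γ.potentialBound / ε), eventually_ge_atTop q]
      with p hp2 hqp hp0 hp
    have : NeZero p := ⟨hp0.ne'⟩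
    obtain ⟨hsph, hpair⟩ := hf p hp
    have h1 := Γ.energy_eq_of_isEigenpair hp hpair
    have h2 := energy_le_powerMeanForm hΓ hp (f p)
    rw [Γ.mass_eq_one_of_mem_unitSphere hp hsph, mul_one] at h1 h2
    have h3 := Γ.powerMeanForm_antitone hq hqp (Γ.rpow_half_mem_nonnegSphere hsph).1
    have h4 := hη p hp
    rw [div_le_iff₀ hε] at hp2
    have hpos : (0 : ℝ) < 2 ^ (p - 1) := by positivity
    refine le_trans ?_ h3
    refine le_of_mul_le_mul_left ?_ hpos
    linarith
  have hlim : Γ.topNegEigenvalue ≤ Γ.neg.adjForm h :=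
    ge_of_tendsto (tendsto_powerMeanForm hΓ hh.1)
      ((eventually_gt_atTop 0).mono fun q hq => hbound q hq)
  refine Γ.neg.eq_of_nonneg_of_mulVec_eq hG hs heig ?_ hg0 hh.1 hg1 hh.2
  refine Γ.neg.mulVec_eq_of_le_adjForm ?_
  have h1 : ∑ i, Γ.neg.measure i * h i ^ 2 = 1 := hh.2
  rw [h1, mul_one]
  exact hlim

end SignedGraph

/-! ### Assembly of the three statements -/

/-- The restriction to `⊤` lives on a subtype, so it is compared with `Γ` through the quadratic
forms on `V`, which coincide. -/
theorem SignedGraph.topNegEigenvalue_le_of_restrict_top_le {V : Type*} [Fintype V] [Nonempty V]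
    (Γ : SignedGraph V) {H : Γ.graph.Subgraph} [Fintype H.verts]
    [Fintype (⊤ : Γ.graph.Subgraph).verts]
    (hle : (Γ.restrict ⊤).topNegEigenvalue ≤ (Γ.restrict H).topNegEigenvalue) :
    Γ.topNegEigenvalue ≤ (Γ.restrict H).topNegEigenvalue := by
  refine le_trans ?_ hle
  obtain ⟨g, hg, heig⟩ := Γ.neg.exists_topEigenvector
  have h := Γ.subgraphForm_le ⊤ rfl g
  have h' : Γ.subgraphForm ⊤ g = Γ.neg.adjForm g := by
    unfold subgraphForm adjForm
    refine Finset.sum_congr rfl fun i _ => Finset.sum_congr rfl fun j _ => ?_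
    rw [adjMatrix, Matrix.of_apply, sgn_neg, SimpleGraph.Subgraph.top_adj, ite_mul, zero_mul]
    rfl
  rw [h', Γ.neg.adjForm_eq_of_mulVec_eq heig] at h
  exact le_of_mul_le_mul_right h (Γ.neg.sum_measure_mul_sq_pos hg)

theorem theorem7p3 {V : Type*} [Fintype V] [Nonempty V] (Γ : SignedGraph V) :
    -- for even `p` the `p`-Laplacian is the operator of the symmetric tensor of order `p`,
    -- and its eigenpairs are those of the normalized tensor
    (∀ (p : ℕ) [NeZero p], Even p →
      (Γ.laplacianTensor p).IsSymmetric ∧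
      (∀ f : V → ℝ, Γ.pLaplacian p f = (Γ.laplacianTensor p).apply f) ∧
      (∀ (lam : ℝ) (f : V → ℝ),
        Γ.IsLaplacianEigenpair p lam f ↔ (Γ.normTensor p).IsEigenpair lam f)) ∧
    -- the largest eigenvalue `η p` of the normalized tensor exists
    ∃ η : ℕ → ℝ,
      (∀ (p : ℕ) [NeZero p], Even p → IsGreatest (Γ.normTensor p).eigenvalues (η p)) ∧
      -- the lower bound; the maximum over all subgraphs is also the one over spanning subgraphs
      (∃ M : ℝ,
        IsGreatest {x : ℝ | ∃ H : Γ.graph.Subgraph, H.verts.Nonempty ∧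
          x = (Γ.restrict H).topNegEigenvalue} M ∧
        IsGreatest {x : ℝ | ∃ H : Γ.graph.Subgraph, Fintype.card H.verts = Fintype.card V ∧
          x = matrixEigenvalue (Γ.restrict H).neg.normAdjMatrix (Fintype.card V)} M ∧
        ∀ (p : ℕ) [NeZero p], Even p → 2 ^ (p - 1) * M - Γ.potentialBound ≤ η p) ∧
      -- the limit of the normalized top eigenvectors for the all-negative signature
      (Γ.graph.Connected → Γ.AllNegative →
        ∃ g : V → ℝ,
          (g ≠ 0 ∧ Γ.neg.normAdjMatrix.mulVec g = Γ.topNegEigenvalue • g) ∧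
          ∀ f : ℕ → V → ℝ,
            (∀ (p : ℕ) [NeZero p], Even p →
              f p ∈ Γ.unitSphere p ∧ (Γ.normTensor p).IsEigenpair (η p) (f p)) →
            ∀ i, Tendsto (fun p : ℕ => |f p i| ^ ((p : ℝ) / 2))
              (atTop ⊓ 𝓟 {p : ℕ | Even p}) (𝓝 (g i))) := by
  refine ⟨fun p _ hp => ⟨Γ.isSymmetric_laplacianTensor hp, Γ.pLaplacian_eq_apply hp,
    Γ.isLaplacianEigenpair_iff hp⟩, ?_⟩
  have hex : ∀ p : ℕ, ∃ c : ℝ, ∀ [NeZero p], Even p →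
      IsGreatest (Γ.normTensor p).eigenvalues c ∧ ∀ g, Γ.energy p g ≤ c * Γ.mass p g := by
    intro p
    by_cases h : NeZero p ∧ Even p
    · obtain ⟨h0, hp⟩ := h
      obtain ⟨c, hc⟩ := Γ.exists_isGreatest_eigenvalues hp
      exact ⟨c, fun _ => hc⟩
    -- For `p` odd or zero the value of `η` is arbitrary.
    · exact ⟨0, fun {h0} hp => absurd ⟨h0, hp⟩ h⟩
  choose η hη using hex
  obtain ⟨H, hH, hmax⟩ := Γ.exists_isGreatest_topNegEigenvalue
  have hHne : H.verts.Nonempty := hH ▸ Set.univ_nonempty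
  have hcard : Fintype.card H.verts = Fintype.card V := by
    rw [← Set.toFinset_card, Finset.card_eq_iff_eq_univ, ← Set.toFinset_univ]
    exact Set.toFinset_congr hH
  have hbound : ∀ (p : ℕ) [NeZero p], Even p →
      2 ^ (p - 1) * (Γ.restrict H).topNegEigenvalue - Γ.potentialBound ≤ η p :=
    fun p _ hp => Γ.lower_bound_of_energy_le H hHne hp (hη p hp).2
  refine ⟨η, fun p _ hp => (hη p hp).1, ⟨(Γ.restrict H).topNegEigenvalue, ⟨⟨H, hHne, rfl⟩, ?_⟩,
    ⟨⟨H, hcard, by rw [← hcard]; rfl⟩, ?_⟩, hbound⟩, fun hG hΓ => ?_⟩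
  · rintro x ⟨H', hH', rfl⟩
    exact hmax H' hH'
  · rintro x ⟨H', hH', rfl⟩
    have hne : Nonempty H'.verts := Fintype.card_pos_iff.1 (hH' ▸ Fintype.card_pos)
    rw [← hH']
    exact hmax H' (Set.nonempty_coe_sort.1 hne)
  · refine Γ.exists_tendsto_rpow_half hG hΓ fun p _ hp => le_trans ?_ (hbound p hp)
    refine sub_le_sub_right (mul_le_mul_of_nonneg_left ?_ (by positivity)) _
    exact Γ.topNegEigenvalue_le_of_restrict_top_le (hmax ⊤ Set.univ_nonempty)
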